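/- Fix $n\ge 1$. Let $\mathbb W=C([0,1],\mathbb R^n)$ with its Borel $\sigma$-algebra and coordinate process $W$, let $H=\{\int_0^\cdot\dot h(s)\,ds:\dot h\in L^2([0,1],\mathbb R^n)\}$ be the Cameron–Martin space, with $|h|_H=|\dot h|_{L^2}$, and let $\nu$ be a probability measure on $\mathbb W$. All filtrations are completed with respect to $\nu$, and $(\mathcal F_t)$ denotes the filtration of $W$. Let $\mathcal D$ be the set of ($\nu$-a.s. classes of) measurable $u:\mathbb W\to H$ whose density $\dot u$ is $(\mathcal F_t)$-adapted and $d\nu\times dt$-a.s. bounded by a constant. For a $\nu$-Brownian motion $\beta$ with respect to $(\mathcal F_t)$ and $u\in\mathcal D$ write $$\delta_\beta u=\int_0^1\dot u(s)\,d\beta(s)\ \text{(It\^o integral)},\qquad \rho(-\delta_\beta u)=\exp\Big(-\int_0^1\dot u(s)\,d\beta(s)-\tfrac12\int_0^1|\dot u(s)|^2ds\Big).$$ Assume given a process $\beta:\mathbb W\to\mathbb W$ and a family of processes $W^u:\mathbb W\to\mathbb W$, $u\in\mathcal D$, such that (i) $\beta$ is a standard $n$-dimensional $\nu$-Brownian motion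 whose filtration is equal to $(\mathcal F_t)$; (ii) $W^0=W$ $\nu$-a.s.; (iii) for every $u\in\mathcal D$, the law of $W^u$ under the measure $\tilde\nu^u$ given by $d\tilde\nu^u/d\nu=\rho(-\delta_\beta u)$ is $\nu$; (iv) for every $u\in\mathcal D$, $\beta\circ W^u=\beta+u$ $\nu$-a.s.; (v) for all $u,v\in\mathcal D$, $W^u\circ W^v=W^{v+u\circ W^v}$ $\nu$-a.s. **Theorem 1.** Let $u\in\mathcal D$ and suppose that there is a measurable map $V:\mathbb W\to\mathbb W$ with $V\circ W^u=I_{\mathbb W}$ $\nu$-a.s. Then $W^u\circ V=I_{\mathbb W}$ $\nu$-a.s.; moreover $V\nu\ll\nu$, so that $v:=-u\circ V$ is well defined $\nu$-a.s., and $v\in\mathcal D$ and $V=W^v$ $\nu$-a.s. Furthermore the image measures $W^u\nu$ and $W^v\nu$ are absolutely continuous with respect to $\nu$, and $$\frac{dW^u\nu}{d\nu}=\rho(-\delta_\beta v),\qquad \frac{dW^v\nu}{d\nu}=\rho(-\delta_\beta u).$$ -/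

import Mathlib

open MeasureTheory ProbabilityTheory Filter Topology
open scoped unitInterval ENNReal

namespace WienerShift

/-- The state space `ℝⁿ` with its Euclidean norm. -/
abbrev State (n : ℕ) : Type := EuclideanSpace ℝ (Fin n)

/-- The path space `C([0,1], ℝⁿ)`. -/
abbrev PathSpace (n : ℕ) : Type := C(I, State n)

/-- The path space carries the Borel σ-algebra of the uniform topology. -/
instance instMeasurableSpacePathSpace (n : ℕ) : MeasurableSpace (PathSpace n) := borel (PathSpace n)

instance instBorelSpacePathSpace (n : ℕ) : BorelSpace (PathSpace n) := ⟨rfl⟩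

/-- The Cameron-Martin space `H = {∫₀^· ḣ(s) ds : ḣ ∈ L²([0,1], ℝⁿ)}`. An element `h` is
represented by its density `ḣ`, so that `|h|_H` is the `L²` norm of `ḣ`. -/
abbrev CM (n : ℕ) : Type := Lp (State n) 2 (volume : Measure I)

variable {n : ℕ}

/-- The path `t ↦ ∫₀ᵗ ḣ(s) ds` of an element of the Cameron-Martin space. -/
noncomputable def cmPath (h : CM n) (t : I) : State n := ∫ s in Set.Iic t, h s

/-- The filtration `σ(Y(s), s ≤ t)` of a process `Y` with continuous paths, completed with
respect to `ν`. For `Y = id` it is the filtration of the coordinate process. -/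
abbrev completedFiltration (ν : Measure (PathSpace n)) (Y : PathSpace n → PathSpace n) (t : I) :
    MeasurableSpace (PathSpace n) :=
  eventuallyMeasurableSpace
    (⨆ s ≤ t, MeasurableSpace.comap (fun ω => Y ω s) inferInstance) (ae ν)

/-- `B` is a standard `n`-dimensional Brownian motion on `[0,1]` under `ν`, started at `0`. -/
structure IsBrownianMotion (ν : Measure (PathSpace n)) (B : PathSpace n → PathSpace n) : Prop where
  start : ∀ᵐ ω ∂ν, B ω 0 = 0
  indep : HasIndepIncrements (fun (t : I) ω => B ω t) ν
  law : ∀ s t : I, s ≤ t →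
    HasLaw (fun ω => B ω t - B ω s)
      ((stdGaussian (State n)).map (fun x => Real.sqrt ((t : ℝ) - (s : ℝ)) • x)) ν

/-- `u ∈ L⁰(ν, H)` has an adapted density: there is a jointly measurable process `U`, adapted to
the completed filtration of the coordinate process, such that `U(·, ω)` is the density of `u(ω)`
for `ν`-almost every `ω`. -/
def HasAdaptedDensity {ν : Measure (PathSpace n)} (u : PathSpace n →ₘ[ν] CM n) : Prop :=
  ∃ U : I → PathSpace n → State n,
    Measurable (Function.uncurry U) ∧
    (∀ t, Measurable[completedFiltration ν id t] (U t)) ∧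
    ∀ᵐ ω ∂ν, ∀ᵐ t : I, u ω t = U t ω

/-- The set `𝒟` of those `u ∈ L⁰(ν, H)` whose density is adapted and almost surely bounded
(by a constant). -/
def boundedShifts (ν : Measure (PathSpace n)) : Set (PathSpace n →ₘ[ν] CM n) :=
  {u | HasAdaptedDensity u ∧ ∃ C : ℝ, ∀ᵐ ω ∂ν, ∀ᵐ t : I, ‖u ω t‖ ≤ C}

/-- Simple adapted processes `∑_{i < N} ξᵢ 1_{(tᵢ, tᵢ₊₁]}` with `ξᵢ` bounded and measurable with
respect to the completed filtration of the coordinate process at time `tᵢ`. -/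
structure SimpleProcess (ν : Measure (PathSpace n)) where
  /-- the number of intervals -/
  N : ℕ
  /-- the subdivision points -/
  time : ℕ → I
  mono : Monotone time
  /-- the values on the intervals -/
  coef : ℕ → PathSpace n → State n
  adapted : ∀ i, Measurable[completedFiltration ν id (time i)] (coef i)
  bounded : ∃ C : ℝ, ∀ i ω, ‖coef i ω‖ ≤ C

/-- The value of a simple process at time `s`. -/
noncomputable def SimpleProcess.eval {ν : Measure (PathSpace n)} (S : SimpleProcess ν)
    (ω : PathSpace n) (s : I) : State n :=
  ∑ i ∈ Finset.range S.N, (Set.Ioc (S.time i) (S.time (i + 1))).indicator (fun _ => S.coef i ω) s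

/-- The stochastic integral `∑ᵢ ⟨ξᵢ, B(tᵢ₊₁) - B(tᵢ)⟩` of a simple process. -/
noncomputable def SimpleProcess.integral {ν : Measure (PathSpace n)} (S : SimpleProcess ν)
    (B : PathSpace n → PathSpace n) (ω : PathSpace n) : ℝ :=
  ∑ i ∈ Finset.range S.N, inner ℝ (S.coef i ω) (B ω (S.time (i + 1)) - B ω (S.time i))

/-- `J` is (a version of) the Itô integral `∫₀¹ u̇(s) dB(s)`: the `L²(ν)` limit of the integrals of
simple processes that converge to `u̇` in `L²(dν × dt)`. -/
def IsItoIntegral {ν : Measure (PathSpace n)} (B : PathSpace n → PathSpace n) (u : PathSpace n →ₘ[ν] CM n)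
    (J : PathSpace n → ℝ) : Prop :=
  AEStronglyMeasurable J ν ∧
  ∃ S : ℕ → SimpleProcess ν,
    Tendsto (fun k => ∫⁻ ω, ∫⁻ s : I, ‖(S k).eval ω s - u ω s‖ₑ ^ 2 ∂volume ∂ν) atTop (𝓝 0) ∧
    Tendsto (fun k => eLpNorm (fun ω => (S k).integral B ω - J ω) 2 ν) atTop (𝓝 0)

open Classical in
/-- The stochastic integral `δ_B u = ∫₀¹ u̇(s) dB(s)`, for a Brownian motion `B` of the filtration
and an adapted `u̇ ∈ L²(dν × dt)`; it is unique up to `ν`-almost sure equality. -/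
noncomputable def stochInt {ν : Measure (PathSpace n)} (B : PathSpace n → PathSpace n) (u : PathSpace n →ₘ[ν] CM n) :
    PathSpace n → ℝ :=
  if h : ∃ J, IsItoIntegral B u J then h.choose else 0

/-- The Wick exponential `ρ(δ_B u) = exp(∫₀¹ u̇(s) dB(s) - ½ ∫₀¹ |u̇(s)|² ds)`. -/
noncomputable def wickExp {ν : Measure (PathSpace n)} (B : PathSpace n → PathSpace n) (u : PathSpace n →ₘ[ν] CM n)
    (ω : PathSpace n) : ℝ :=
  Real.exp (stochInt B u ω - (1 / 2) * ∫ s : I, ‖u ω s‖ ^ 2)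

/-- The measure with density `ρ(-δ_B u) = ρ(δ_B (-u))` with respect to `ν`. -/
noncomputable def girsanovMeasure (ν : Measure (PathSpace n)) (B : PathSpace n → PathSpace n)
    (u : PathSpace n →ₘ[ν] CM n) : Measure (PathSpace n) :=
  ν.withDensity (fun ω => ENNReal.ofReal (wickExp B (-u) ω))

end WienerShift

open WienerShift

/-! Write `μ` for the measure with density `ρ(-δ_β u)` and `X = β ∘ W u = β + u`. Since `W u`
carries `μ` to `ν`, a left inverse `V` carries `ν` back to `μ`, which is equivalent to `ν`. The set
where `W u ∘ V = id` contains almost every point of the form `W u ω`, hence has full `ν`-measure. So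
`V` inverts `W u` on both sides almost surely, and `X ∘ V = β`.

The difficulty is that `v = -u ∘ V` must be adapted, that is, `V⁻¹ A ∈ ℱ_t` for `A ∈ ℱ_t`. As `ℱ_1`
is generated by `β`, there is `D` with `V⁻¹ A = {β ∈ D}`, whence `A = {X ∈ D}`. Under `μ` the
increments of `X` after `t` are independent of `ℱ_t` (`indep_incrAfter`), so by Fubini they can be
frozen at a deterministic path `y`: `A` is the event that `X` stopped at `t`, plus `y`, lies in `D`
(`exists_ae_eq_stopAt`). Composing with `V` replaces `X` by `β`, and the stopped `β` is
`ℱ_t`-measurable.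

This independence is Girsanov's theorem, and it follows from the mere fact that every density has
mass one, which the law hypothesis provides. Perturbing `u` by a step shift switched on after `t` on
an event `A ∈ ℱ_t`, mass one becomes the Laplace transform of the later increments of `X` on `A`
(`setLIntegral_exp_incrAfter`), with the same value, relative to the mass of `A`, for every `A`. The
computation requires additivity of the Itô integral, hence its existence for bounded adapted
integrands and its uniqueness by isometry.

Finally `β ∘ V = β + v = β ∘ W v`, and the path is almost surely a function of `β`, so `V = W v`;
the two image laws then follow from the law hypothesis for `u` and for `v`. -/

namespace WienerShift

/-! ### Completed σ-algebras. -/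

section EventuallyMeasurable

/-- A map into a standard Borel space that is measurable with respect to a completed `σ`-algebra
agrees almost everywhere with a map that is measurable with respect to the `σ`-algebra itself. -/
theorem exists_measurable_eventuallyEq {α E : Type*} {m : MeasurableSpace α} {l : Filter α}
    [CountableInterFilter l] [MeasurableSpace E] [StandardBorelSpace E] [Nonempty E] {f : α → E}
    (hf : Measurable[eventuallyMeasurableSpace m l] f) :
    ∃ g : α → E, Measurable[m] g ∧ f =ᶠ[l] g := by
  -- Embedding `E` in `ℕ → Bool` reduces the map to countably many events, each of which may be
  -- replaced off a null set.
  have hΦ : MeasurableEmbedding (MeasurableSpace.mapNatBool E) :=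
    (MeasurableSpace.measurable_mapNatBool E).measurableEmbedding
      (MeasurableSpace.injective_mapNatBool E)
  have hset : ∀ k, ∃ A : Set α, MeasurableSet[m] A ∧
      (fun ω => MeasurableSpace.mapNatBool E (f ω) k) ⁻¹' {true} =ᶠ[l] A := by
    intro k
    have : Measurable[eventuallyMeasurableSpace m l]
        (fun ω => MeasurableSpace.mapNatBool E (f ω) k) :=
      ((measurable_pi_apply k).comp hΦ.measurable).comp hf
    exact this (measurableSet_singleton true)
  choose A hA hAf using hset
  classical
  let G : α → ℕ → Bool := fun ω k => decide (ω ∈ A k)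
  have hG : Measurable[m] G := by
    refine @measurable_pi_lambda _ _ _ m _ _ fun k => ?_
    refine @measurable_to_bool _ m _ ?_
    have : (fun ω => G ω k) ⁻¹' {true} = A k := by ext ω; simp [G]
    rw [this]; exact hA k
  refine ⟨fun ω => hΦ.invFun (G ω), hΦ.measurable_invFun.comp hG, ?_⟩
  filter_upwards [eventually_countable_forall.2 fun k => (hAf k).mem_iff] with ω hω
  have : G ω = MeasurableSpace.mapNatBool E (f ω) := by
    funext k
    have h := hω k
    simp only [Set.mem_preimage, Set.mem_singleton_iff] at h
    by_cases hk : ω ∈ A k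
    · simp only [G, hk, decide_true, h.2 hk]
    · simp only [G, hk, decide_false]
      by_contra hne
      exact hk (h.1 (by simpa using Ne.symm hne))
  change f ω = hΦ.invFun (G ω)
  rw [this, hΦ.leftInverse_invFun]

/-- Completing the first `σ`-algebra preserves independence. -/
theorem Indep.eventuallyMeasurableSpace_left {Ω : Type*} {m₁ m₂ m₀ : MeasurableSpace Ω}
    {μ : Measure Ω} (h : Indep m₁ m₂ μ) :
    Indep (eventuallyMeasurableSpace m₁ (ae μ)) m₂ μ := by
  rw [Indep_iff] at h ⊢
  rintro s t ⟨s', hs', hss'⟩ ht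
  rw [measure_congr (hss'.inter (EventuallyEq.refl _ t)), measure_congr hss', h s' t hs' ht]

theorem ae_eq_preimage_of_measurable_comap {Ω E : Type*} {m₀ : MeasurableSpace Ω}
    {μ : Measure Ω} [MeasurableSpace E] {Y : Ω → E} {A : Set Ω}
    (hA : MeasurableSet[eventuallyMeasurableSpace
      (MeasurableSpace.comap Y inferInstance) (ae μ)] A) :
    ∃ D : Set E, MeasurableSet D ∧ A =ᵐ[μ] Y ⁻¹' D := by
  obtain ⟨A', ⟨D, hD, rfl⟩, hAA'⟩ := hA
  exact ⟨D, hD, hAA'⟩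

end EventuallyMeasurable

/-! ### Borel structure and filtrations of the path space. -/

section PathSpace

variable {n : ℕ}

/-- A continuous injection from a Polish space is a Borel embedding, so countably many evaluations
generate the Borel σ-algebra. -/
theorem measurableEmbedding_eval_denseSeq :
    MeasurableEmbedding (fun (f : PathSpace n) (k : ℕ) => f (TopologicalSpace.denseSeq I k)) := by
  refine Continuous.measurableEmbedding (by fun_prop) fun f g hfg => ?_
  refine DFunLike.coe_injective ?_
  refine (TopologicalSpace.denseRange_denseSeq I).equalizer f.continuous g.continuous ?_
  exact hfg

/-- The Borel `σ`-algebra of the path space is generated by the evaluation maps. -/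
theorem measurable_pathSpace {Ω : Type*} {m : MeasurableSpace Ω} {f : Ω → PathSpace n}
    (hf : ∀ t, Measurable fun ω => f ω t) : Measurable f :=
  measurableEmbedding_eval_denseSeq.measurable_comp_iff.1
    (measurable_pi_lambda _ fun _ => hf _)

theorem measurable_eval (t : I) : Measurable fun f : PathSpace n => f t :=
  (continuous_eval_const t).measurable

/-- The path stopped at time `t`. -/
noncomputable def stopAt (t : I) (f : PathSpace n) : PathSpace n :=
  f.comp ⟨fun s => min s t, by fun_prop⟩

/-- The increments of the path after time `t`. -/
noncomputable def incrAfter (t : I) (f : PathSpace n) : PathSpace n :=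
  f.comp ⟨fun s => max s t, by fun_prop⟩ - ContinuousMap.const I (f t)

@[simp] theorem stopAt_apply (t : I) (f : PathSpace n) (s : I) : stopAt t f s = f (min s t) := rfl

@[simp] theorem incrAfter_apply (t : I) (f : PathSpace n) (s : I) :
    incrAfter t f s = f (max s t) - f t := rfl

theorem stopAt_add_incrAfter (t : I) (f : PathSpace n) : stopAt t f + incrAfter t f = f := by
  ext1 s
  rcases le_total s t with h | h <;> simp [h]

theorem measurable_incrAfter (t : I) : Measurable (incrAfter (n := n) t) :=
  measurable_pathSpace fun _ => (measurable_eval _).sub (measurable_eval _)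

/-- The `σ`-algebra of the coordinate process up to time `t`, not completed. -/
abbrev rawFiltration (n : ℕ) (t : I) : MeasurableSpace (PathSpace n) :=
  ⨆ s ≤ t, MeasurableSpace.comap (fun ω : PathSpace n => (id ω) s) inferInstance

theorem rawFiltration_le (t : I) : rawFiltration n t ≤ instMeasurableSpacePathSpace n :=
  iSup₂_le fun s _ => (measurable_eval s).comap_le

variable {ν : Measure (PathSpace n)}

theorem completedFiltration_mono (Y : PathSpace n → PathSpace n) {s t : I} (h : s ≤ t) :
    completedFiltration ν Y s ≤ completedFiltration ν Y t := by
  rintro A ⟨A', hA', hAA'⟩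
  have hle : (⨆ r ≤ s, MeasurableSpace.comap (fun ω => Y ω r) inferInstance) ≤
      ⨆ r ≤ t, MeasurableSpace.comap (fun ω => Y ω r) inferInstance :=
    iSup₂_le fun r hr => le_iSup₂_of_le r (hr.trans h) le_rfl
  exact ⟨A', hle _ hA', hAA'⟩

theorem measurable_completedFiltration_eval (Y : PathSpace n → PathSpace n) {s t : I}
    (h : s ≤ t) : Measurable[completedFiltration ν Y t] fun ω => Y ω s := by
  refine Measurable.mono (?_ : Measurable[⨆ r ≤ t, MeasurableSpace.comap (fun ω => Y ω r)
    inferInstance] fun ω => Y ω s) le_eventuallyMeasurableSpace le_rfl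
  rw [measurable_iff_comap_le]
  exact le_iSup₂_of_le s h le_rfl

theorem measurable_completedFiltration_stopAt (Y : PathSpace n → PathSpace n) (t : I) :
    Measurable[completedFiltration ν Y t] fun ω => stopAt t (Y ω) :=
  @measurable_pathSpace _ _ (completedFiltration ν Y t) _
    fun _ => measurable_completedFiltration_eval Y (min_le_right _ _)

theorem measurableSet_completedFiltration_of_ae {t : I} {A B : Set (PathSpace n)}
    (hA : MeasurableSet[completedFiltration ν id t] A) (h : B =ᵐ[ν] A) :
    MeasurableSet[completedFiltration ν id t] B :=
  EventuallyMeasurableSet.congr hA h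

theorem measurable_completedFiltration_congr {t : I} {E : Type*} [MeasurableSpace E]
    {f g : PathSpace n → E}
    (hf : Measurable[completedFiltration ν id t] f) (h : g =ᵐ[ν] f) :
    Measurable[completedFiltration ν id t] g :=
  EventuallyMeasurable.congr hf h

theorem aemeasurable_of_completedFiltration {t : I} {E : Type*} [MeasurableSpace E]
    [StandardBorelSpace E] [Nonempty E] {f : PathSpace n → E}
    (hf : Measurable[completedFiltration ν id t] f) : AEMeasurable f ν := by
  obtain ⟨g, hg, hfg⟩ := exists_measurable_eventuallyEq hf
  exact ⟨g, hg.mono (rawFiltration_le t) le_rfl, hfg⟩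

/-- The last `σ`-algebra of a completed filtration is the completed `σ`-algebra of the path. -/
theorem completedFiltration_one (Y : PathSpace n → PathSpace n) :
    completedFiltration ν Y 1 =
      eventuallyMeasurableSpace (MeasurableSpace.comap Y inferInstance) (ae ν) := by
  have : (⨆ r ≤ (1 : I), MeasurableSpace.comap (fun ω => Y ω r) inferInstance) =
      MeasurableSpace.comap Y inferInstance := by
    refine le_antisymm (iSup₂_le fun r _ => ?_) ?_
    · rw [← measurable_iff_comap_le]
      exact (measurable_eval r).comp (comap_measurable Y)
    · rw [← measurable_iff_comap_le]
      refine @measurable_pathSpace _ _ (_) _ fun r => ?_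
      rw [measurable_iff_comap_le]
      exact le_iSup₂_of_le r (unitInterval.le_one r) le_rfl
  unfold completedFiltration
  rw [this]

theorem measurable_completedFiltration_one {E : Type*} [MeasurableSpace E] {f : PathSpace n → E}
    (hf : Measurable f) : Measurable[completedFiltration ν id 1] f := by
  rw [completedFiltration_one, MeasurableSpace.comap_id]
  exact hf.mono le_eventuallyMeasurableSpace le_rfl

end PathSpace

/-! ### Independence of past and future increments. -/

section IndependentIncrements

/-- The past of a process with independent increments starting at `0` is independent of each
future increment. -/
theorem HasIndepIncrements.indepFun_past {Ω E : Type*} {mΩ : MeasurableSpace Ω} {P : Measure Ω}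
    [IsProbabilityMeasure P]
    [AddCommGroup E] [MeasurableSpace E] [MeasurableAdd₂ E] [MeasurableSub₂ E]
    {X : I → Ω → E} (hX : HasIndepIncrements X P)
    (hm : ∀ t, AEMeasurable (X t) P) (h0 : ∀ᵐ ω ∂P, X 0 ω = 0) {s t : I} (hst : s ≤ t) :
    IndepFun (fun ω (r : Set.Iic s) => X r ω) (fun ω => X t ω - X s ω) P := by
  refine IndepFun.process_indepFun₀ (fun r => hm r) ((hm t).sub (hm s)) fun J => ?_
  let K : Finset I := J.map (Function.Embedding.subtype _)
  have hK : ∀ r ∈ K, r ≤ s := by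
    intro r hr
    obtain ⟨r', -, rfl⟩ := Finset.mem_map.1 hr
    exact r'.2
  let e := K.orderIsoOfFin rfl
  -- The subdivision is `0`, then the points of `K` in increasing order, then `s`, then `t` forever.
  -- Increments with index at most `K.card` belong to the past; the one with index `K.card + 1` runs
  -- from `s` to `t`.
  let τ : ℕ → I := fun i =>
    if i = 0 then 0 else if h : i - 1 < K.card then (e ⟨i - 1, h⟩ : I) else
      if i = K.card + 1 then s else t
  have hτ : Monotone τ := by
    refine monotone_nat_of_le_succ fun i => ?_
    rcases Nat.eq_zero_or_pos i with rfl | hi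
    · simp [τ]
    obtain ⟨j, rfl⟩ : ∃ j, i = j + 1 := ⟨i - 1, by omega⟩
    by_cases h1 : j + 1 < K.card
    · have h2 : j < K.card := by omega
      simp only [τ, Nat.add_sub_cancel, h1, h2, dif_pos, Nat.succ_ne_zero, if_false]
      simp
    · by_cases h2 : j < K.card
      · have h3 : j + 1 + 1 = K.card + 1 := by omega
        simp only [τ, Nat.add_sub_cancel, h2, dif_pos, h3, Nat.succ_ne_zero, if_false]
        simpa using hK _ (e ⟨j, h2⟩).2
      · have h3 : ¬ (j + 1 + 1 = K.card + 1) := by omega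
        simp only [τ, Nat.add_sub_cancel, h1, h2, h3, Nat.succ_ne_zero, if_false, dif_neg,
          not_false_eq_true]
        split_ifs
        exacts [hst, le_rfl]
  have hτs : τ (K.card + 1) = s := by simp [τ]
  have hτt : τ (K.card + 1 + 1) = t := by simp [τ]
  have hτe : ∀ j : Fin K.card, τ (j + 1) = e j := by intro j; simp [τ]
  have hincr := hX.nat hτ
  have hmi : ∀ i, AEMeasurable (fun ω => X (τ (i + 1)) ω - X (τ i) ω) P :=
    fun i => (hm _).sub (hm _)
  have hind := hincr.indepFun_finset₀ (Finset.range (K.card + 1)) {K.card + 1} (by simp) hmi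
  let idx : J → ℕ := fun r => e.symm ⟨r, Finset.mem_map.2 ⟨r, r.2, rfl⟩⟩
  have hidx : ∀ r : J, idx r < K.card := fun r => Fin.is_lt _
  have hτidx : ∀ r : J, τ (idx r + 1) = (r : Set.Iic s) := by
    intro r
    rw [hτe]
    simp
  -- Since `X 0 = 0`, each past value is a telescoping sum of past increments.
  let φ : (Finset.range (K.card + 1) → E) → J → E :=
    fun x r => ∑ i : Fin (idx r + 1), x ⟨i, by
      have := i.2; have := hidx r; simp; omega⟩
  let ψ : (({K.card + 1} : Finset ℕ) → E) → E := fun x => x ⟨K.card + 1, by simp⟩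
  have hφ : Measurable φ := by
    refine measurable_pi_lambda _ fun r => ?_
    exact Finset.measurable_fun_sum _ fun i _ => measurable_pi_apply _
  have hψ : Measurable ψ := measurable_pi_apply _
  refine (hind.comp hφ hψ).congr ?_ ?_
  · filter_upwards [h0] with ω hω
    funext r
    simp only [Function.comp, φ]
    rw [Fin.sum_univ_eq_sum_range (fun i => X (τ (i + 1)) ω - X (τ i) ω) (idx r + 1),
      Finset.sum_range_sub (fun i => X (τ i) ω), hτidx]
    have : τ 0 = 0 := by simp [τ]
    simp [this, hω]
  · filter_upwards with ω
    simp only [Function.comp, ψ, hτs, hτt]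

end IndependentIncrements

/-! ### Moments of Brownian increments against the past. -/

section BrownianMotion

variable {n : ℕ} {ν : Measure (PathSpace n)}
  {β : PathSpace n → PathSpace n}

theorem measurable_brownian (hfilt : ∀ t, completedFiltration ν β t = completedFiltration ν id t)
    {s t : I} (hst : s ≤ t) : Measurable[completedFiltration ν id t] fun ω => β ω s := by
  rw [← hfilt t]
  exact measurable_completedFiltration_eval β hst

theorem measurable_brownian_stopAt
    (hfilt : ∀ t, completedFiltration ν β t = completedFiltration ν id t) (t : I) :
    Measurable[completedFiltration ν id t] fun ω => stopAt t (β ω) := by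
  rw [← hfilt t]
  exact measurable_completedFiltration_stopAt β t

theorem measurable_brownian_one
    (hfilt : ∀ t, completedFiltration ν β t = completedFiltration ν id t) :
    Measurable[completedFiltration ν id 1] β := by
  rw [← hfilt 1, completedFiltration_one]
  exact (comap_measurable β).mono le_eventuallyMeasurableSpace le_rfl

theorem aemeasurable_brownian
    (hfilt : ∀ t, completedFiltration ν β t = completedFiltration ν id t) (t : I) :
    AEMeasurable (fun ω => β ω t) ν :=
  aemeasurable_of_completedFiltration (measurable_brownian hfilt le_rfl)

theorem memLp_apply {p : ℝ≥0∞} {f : PathSpace n → State n} (hf : MemLp f p ν) (i : Fin n) :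
    MemLp (fun ω => f ω i) p ν :=
  (EuclideanSpace.proj (𝕜 := ℝ) i).comp_memLp' hf

theorem IsBrownianMotion.memLp_increment (hβ : IsBrownianMotion ν β) {s t : I} (hst : s ≤ t) :
    MemLp (fun ω => β ω t - β ω s) 2 ν := by
  have hl := hβ.law s t hst
  have : MemLp id 2 (Measure.map (fun ω => β ω t - β ω s) ν) := by
    rw [hl.map_eq, memLp_map_measure_iff (by fun_prop) (by fun_prop)]
    exact (IsGaussian.memLp_two_id (μ := stdGaussian (State n))).const_smul
      (Real.sqrt ((t : ℝ) - s))
  exact this.comp_of_map hl.aemeasurable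

theorem IsBrownianMotion.integral_increment_apply (hβ : IsBrownianMotion ν β) {s t : I}
    (hst : s ≤ t) (i : Fin n) : ∫ ω, (β ω t - β ω s) i ∂ν = 0 := by
  have hl := hβ.law s t hst
  refine (hl.integral_comp (f := fun x : State n => x i) (by fun_prop)).trans ?_
  rw [integral_map (by fun_prop) (by fun_prop)]
  simp only [PiLp.smul_apply, smul_eq_mul, integral_const_mul]
  have := integral_strongDual_stdGaussian (E := State n) (EuclideanSpace.proj i)
  exact mul_eq_zero_of_right _ this

theorem IsBrownianMotion.integral_increment_mul_apply (hβ : IsBrownianMotion ν β) {s t : I}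
    (hst : s ≤ t) (i j : Fin n) :
    ∫ ω, (β ω t - β ω s) i * (β ω t - β ω s) j ∂ν =
      ((t : ℝ) - s) * (if i = j then 1 else 0) := by
  have hl := hβ.law s t hst
  refine (hl.integral_comp (f := fun x : State n => x i * x j) (by fun_prop)).trans ?_
  rw [integral_map (by fun_prop) (by fun_prop)]
  have hs : (0 : ℝ) ≤ (t : ℝ) - s := sub_nonneg.2 hst
  simp only [PiLp.smul_apply, smul_eq_mul]
  have h1 : ∀ x : State n, Real.sqrt ((t : ℝ) - s) * x i * (Real.sqrt ((t : ℝ) - s) * x j) =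
      ((t : ℝ) - s) * (x i * x j) := by
    intro x
    rw [mul_mul_mul_comm, Real.mul_self_sqrt hs]
  simp only [h1, integral_const_mul]
  congr 1
  have h2 := congrArg (fun B => B (EuclideanSpace.single i (1 : ℝ)) (EuclideanSpace.single j 1))
    (covarianceBilin_stdGaussian (E := State n))
  have h3 : ∀ (k : Fin n) (z : State n), inner ℝ (EuclideanSpace.single k (1 : ℝ)) z = z k := by
    intro k z
    simp [EuclideanSpace.inner_single_left]
  have h4 : innerSL ℝ (EuclideanSpace.single i (1 : ℝ)) (EuclideanSpace.single j (1 : ℝ)) =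
      if i = j then 1 else 0 := by
    rw [innerSL_apply_apply, h3]
    simp
  rw [h4, covarianceBilin_apply IsGaussian.memLp_two_id] at h2
  simpa only [h3, id_eq, integral_id_stdGaussian, sub_zero] using h2

theorem IsBrownianMotion.memLp_inner_increment (hβ : IsBrownianMotion ν β)
    {s t : I} (hst : s ≤ t) {f : PathSpace n → State n}
    (hf : AEStronglyMeasurable f ν) (hb : ∃ C : ℝ, ∀ ω, ‖f ω‖ ≤ C) :
    MemLp (fun ω => inner ℝ (f ω) (β ω t - β ω s)) 2 ν := by
  obtain ⟨C, hC⟩ := hb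
  have hΔ := hβ.memLp_increment hst
  refine MemLp.of_le_mul (c := C) hΔ (hf.inner hΔ.1) ?_
  filter_upwards with ω
  exact (norm_inner_le_norm _ _).trans (mul_le_mul_of_nonneg_right (hC ω) (norm_nonneg _))

variable [IsProbabilityMeasure ν]

/-- The increments of the Brownian motion are independent of the completed past. -/
theorem IsBrownianMotion.indep_past (hβ : IsBrownianMotion ν β)
    (hfilt : ∀ t, completedFiltration ν β t = completedFiltration ν id t)
    {s t : I} (hst : s ≤ t) :
    Indep (completedFiltration ν id s)
      (MeasurableSpace.comap (fun ω => β ω t - β ω s) inferInstance) ν := by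
  have h := HasIndepIncrements.indepFun_past hβ.indep (aemeasurable_brownian hfilt) hβ.start hst
  rw [IndepFun_iff_Indep] at h
  rw [← hfilt s]
  refine Indep.eventuallyMeasurableSpace_left ?_
  convert h using 1
  simp only [MeasurableSpace.pi, MeasurableSpace.comap_iSup, MeasurableSpace.comap_comp, iSup_subtype]
  rfl

theorem IsBrownianMotion.indepFun_of_measurable (hβ : IsBrownianMotion ν β)
    (hfilt : ∀ t, completedFiltration ν β t = completedFiltration ν id t)
    {s t : I} (hst : s ≤ t) {E : Type*} [MeasurableSpace E] {f : PathSpace n → E}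
    (hf : Measurable[completedFiltration ν id s] f) :
    IndepFun f (fun ω => β ω t - β ω s) ν := by
  rw [IndepFun_iff_Indep]
  exact indep_of_indep_of_le_left (hβ.indep_past hfilt hst) (measurable_iff_comap_le.1 hf)

/-- An increment of the Brownian motion is orthogonal to integrable functions of the past. -/
theorem IsBrownianMotion.integral_inner_increment (hβ : IsBrownianMotion ν β)
    (hfilt : ∀ t, completedFiltration ν β t = completedFiltration ν id t)
    {s t : I} (hst : s ≤ t) {f : PathSpace n → State n}
    (hf : Measurable[completedFiltration ν id s] f) (hfi : Integrable f ν) :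
    ∫ ω, inner ℝ (f ω) (β ω t - β ω s) ∂ν = 0 := by
  have hind := hβ.indepFun_of_measurable hfilt hst hf
  have hΔ := hβ.memLp_increment hst
  have hi : ∀ i, IndepFun (fun ω => f ω i) (fun ω => (β ω t - β ω s) i) ν := fun i =>
    hind.comp (φ := fun x : State n => x i) (ψ := fun x : State n => x i)
      (by fun_prop) (by fun_prop)
  have hf1 : ∀ i, Integrable (fun ω => f ω i) ν := fun i =>
    memLp_one_iff_integrable.1 (memLp_apply (memLp_one_iff_integrable.2 hfi) i)
  have hΔ1 : ∀ i, Integrable (fun ω => (β ω t - β ω s) i) ν := fun i =>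
    (memLp_apply hΔ i).integrable one_le_two
  simp only [PiLp.inner_apply, RCLike.inner_apply, conj_trivial]
  rw [integral_finsetSum]
  · refine Finset.sum_eq_zero fun i _ => ?_
    have := (hi i).integral_fun_mul_eq_mul_integral (hf1 i).aestronglyMeasurable
      (hΔ1 i).aestronglyMeasurable
    simp only [mul_comm ((β _ t - β _ s) i)]
    rw [this, hβ.integral_increment_apply hst, mul_zero]
  · intro i _
    have := (hi i).integrable_mul (hf1 i) (hΔ1 i)
    simpa [mul_comm, Pi.mul_def] using this

/-- Second moments of an increment of the Brownian motion against functions of the past. -/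
theorem IsBrownianMotion.integral_inner_mul_inner (hβ : IsBrownianMotion ν β)
    (hfilt : ∀ t, completedFiltration ν β t = completedFiltration ν id t)
    {s t : I} (hst : s ≤ t) {f g : PathSpace n → State n}
    (hf : Measurable[completedFiltration ν id s] f) (hfb : ∃ C : ℝ, ∀ ω, ‖f ω‖ ≤ C)
    (hg : Measurable[completedFiltration ν id s] g) (hgb : ∃ C : ℝ, ∀ ω, ‖g ω‖ ≤ C) :
    ∫ ω, inner ℝ (f ω) (β ω t - β ω s) * inner ℝ (g ω) (β ω t - β ω s) ∂ν =
      ((t : ℝ) - s) * ∫ ω, inner ℝ (f ω) (g ω) ∂ν := by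
  have hΔ := hβ.memLp_increment hst
  -- The products `f i * g j` have to be independent of the increment, so independence is applied to
  -- the pair.
  have hfg : Measurable[completedFiltration ν id s] fun ω => (f ω, g ω) := hf.prodMk hg
  have hind := hβ.indepFun_of_measurable hfilt hst hfg
  have hf' := (aemeasurable_of_completedFiltration hf).aestronglyMeasurable
  have hg' := (aemeasurable_of_completedFiltration hg).aestronglyMeasurable
  obtain ⟨C, hC⟩ := hfb
  obtain ⟨D, hD⟩ := hgb
  have hfm : MemLp f 2 ν := MemLp.of_bound hf' C (ae_of_all _ hC)
  have hgm : MemLp g 2 ν := MemLp.of_bound hg' D (ae_of_all _ hD)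
  have hfgi : ∀ i j, Integrable (fun ω => f ω i * g ω j) ν := fun i j =>
    (memLp_apply hfm i).integrable_mul (memLp_apply hgm j)
  have hΔi : ∀ i j, Integrable (fun ω => (β ω t - β ω s) i * (β ω t - β ω s) j) ν := fun i j =>
    (memLp_apply hΔ i).integrable_mul (memLp_apply hΔ j)
  have hi : ∀ i j, IndepFun (fun ω => f ω i * g ω j)
      (fun ω => (β ω t - β ω s) i * (β ω t - β ω s) j) ν := fun i j =>
    hind.comp (φ := fun x : State n × State n => x.1 i * x.2 j)
      (ψ := fun x : State n => x i * x j) (by fun_prop) (by fun_prop)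
  have hexp : ∀ ω, inner ℝ (f ω) (β ω t - β ω s) * inner ℝ (g ω) (β ω t - β ω s) =
      ∑ i, ∑ j, (f ω i * g ω j) * ((β ω t - β ω s) i * (β ω t - β ω s) j) := by
    intro ω
    simp only [PiLp.inner_apply, RCLike.inner_apply, conj_trivial]
    rw [Finset.sum_mul_sum]
    refine Finset.sum_congr rfl fun i _ => Finset.sum_congr rfl fun j _ => by ring
  have hint : ∀ i j, Integrable (fun ω => (f ω i * g ω j) *
      ((β ω t - β ω s) i * (β ω t - β ω s) j)) ν := fun i j =>
    (hi i j).integrable_mul (hfgi i j) (hΔi i j)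
  simp only [hexp]
  rw [integral_finsetSum _ fun i _ => integrable_finsetSum _ fun j _ => hint i j]
  simp_rw [integral_finsetSum Finset.univ fun j _ => hint _ j]
  have hval : ∀ i j, ∫ ω, (f ω i * g ω j) * ((β ω t - β ω s) i * (β ω t - β ω s) j) ∂ν =
      (∫ ω, f ω i * g ω j ∂ν) * (((t : ℝ) - s) * (if i = j then 1 else 0)) := by
    intro i j
    rw [(hi i j).integral_fun_mul_eq_mul_integral (hfgi i j).aestronglyMeasurable
      (hΔi i j).aestronglyMeasurable, hβ.integral_increment_mul_apply hst]
  simp only [hval, PiLp.inner_apply, RCLike.inner_apply, conj_trivial]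
  rw [integral_finsetSum _ fun i _ => by simpa only [mul_comm] using hfgi i i, Finset.mul_sum]
  refine Finset.sum_congr rfl fun i _ => ?_
  simp [mul_comm]

end BrownianMotion

/-! ### Step functions in the Cameron–Martin space. -/

section StepFunctions

variable {n : ℕ}

/-- The element of the Cameron-Martin space with density `x 1_{(a, b]}`, as a function of `x`. -/
noncomputable def stepCM (a b : I) : State n →L[ℝ] CM n :=
  LinearMap.toContinuousLinearMap
    { toFun := fun x => indicatorConstLp 2 (measurableSet_Ioc (a := a) (b := b))
        (measure_ne_top _ _) x
      map_add' := fun x y => indicatorConstLp_add.symm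
      map_smul' := fun c x => by
        simp only [RingHom.id_apply]
        refine Lp.ext ?_
        refine indicatorConstLp_coeFn.trans ?_
        refine EventuallyEq.trans ?_ (Lp.coeFn_smul _ _).symm
        filter_upwards [indicatorConstLp_coeFn (p := 2) (hs := measurableSet_Ioc (a := a) (b := b))
          (hμs := measure_ne_top (volume : Measure I) _) (c := x)] with s hs
        rw [Pi.smul_apply, hs]
        exact Set.indicator_const_smul_apply (Set.Ioc a b) c (fun _ => x) s }

theorem stepCM_apply (a b : I) (x : State n) :
    stepCM a b x = indicatorConstLp 2 (measurableSet_Ioc (a := a) (b := b))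
      (measure_ne_top _ _) x := rfl

theorem coeFn_stepCM (a b : I) (x : State n) :
    stepCM a b x =ᵐ[volume] (Set.Ioc a b).indicator fun _ => x :=
  indicatorConstLp_coeFn (hs := measurableSet_Ioc) (hμs := measure_ne_top _ _)

theorem inner_stepCM_stepCM (a b c d : I) (x y : State n) :
    inner ℝ (stepCM a b x) (stepCM c d y) =
      (volume : Measure I).real (Set.Ioc a b ∩ Set.Ioc c d) * inner ℝ x y := by
  rw [stepCM_apply, stepCM_apply, L2.inner_indicatorConstLp_indicatorConstLp]
  rfl

theorem integrable_cm (h : CM n) : Integrable h volume :=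
  (Lp.memLp h).integrable one_le_two

/-- This turns the cross term of a squared Cameron–Martin norm into increments of the drift path. -/
theorem inner_stepCM (a b : I) (hab : a ≤ b) (x : State n) (h : CM n) :
    inner ℝ (stepCM a b x) h = inner ℝ x (cmPath h b - cmPath h a) := by
  rw [stepCM_apply, L2.inner_indicatorConstLp_eq_inner_setIntegral]
  congr 1
  have hset : Set.Ioc a b = Set.Iic b \ Set.Iic a := by
    ext s
    simp [and_comm]
  rw [cmPath, cmPath, hset, setIntegral_sdiff measurableSet_Iic (integrable_cm h).integrableOn
    (Set.Iic_subset_Iic.2 hab)]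

theorem volume_real_Ioc {a b : I} (hab : a ≤ b) :
    (volume : Measure I).real (Set.Ioc a b) = (b : ℝ) - a := by
  rw [Measure.real, unitInterval.volume_Ioc, ENNReal.toReal_ofReal (sub_nonneg.2 hab)]

end StepFunctions

/-! ### Itô's isometry and the closed graph of the integral. -/

section ItoIsometry

variable {n : ℕ} {ν : Measure (PathSpace n)} [IsProbabilityMeasure ν]
  {β : PathSpace n → PathSpace n}

/-- Itô's isometry for two elementary integrands, each supported by one interval. -/
theorem IsBrownianMotion.integral_inner_mul_inner_Ioc (hβ : IsBrownianMotion ν β)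
    (hfilt : ∀ t, completedFiltration ν β t = completedFiltration ν id t)
    {a b c d : I} (hab : a ≤ b) (hcd : c ≤ d) {f g : PathSpace n → State n}
    (hf : Measurable[completedFiltration ν id a] f) (hfb : ∃ C : ℝ, ∀ ω, ‖f ω‖ ≤ C)
    (hg : Measurable[completedFiltration ν id c] g) (hgb : ∃ C : ℝ, ∀ ω, ‖g ω‖ ≤ C) :
    ∫ ω, inner ℝ (f ω) (β ω b - β ω a) * inner ℝ (g ω) (β ω d - β ω c) ∂ν =
      (volume : Measure I).real (Set.Ioc a b ∩ Set.Ioc c d) * ∫ ω, inner ℝ (f ω) (g ω) ∂ν := by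
  have mono : ∀ {s t : I} {h : PathSpace n → State n}, s ≤ t →
      Measurable[completedFiltration ν id s] h → Measurable[completedFiltration ν id t] h :=
    fun hst hh => hh.mono (completedFiltration_mono id hst) le_rfl
  have hL2 : ∀ {s t : I} {h : PathSpace n → State n}, s ≤ t →
      Measurable[completedFiltration ν id s] h → (∃ C : ℝ, ∀ ω, ‖h ω‖ ≤ C) →
      MemLp (fun ω => inner ℝ (h ω) (β ω t - β ω s)) 2 ν := fun hst hh hhb =>
    hβ.memLp_inner_increment hst (aemeasurable_of_completedFiltration hh).aestronglyMeasurable hhb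
  -- Two intervals are cut until the pieces either coincide or are disjoint. In the disjoint case
  -- the earlier factor and `g` together form an `ℱ_c`-measurable vector, orthogonal to the later
  -- increment.
  have disj : ∀ {a b c d : I} {f g : PathSpace n → State n}, a ≤ b → b ≤ c → c ≤ d →
      Measurable[completedFiltration ν id a] f → (∃ C : ℝ, ∀ ω, ‖f ω‖ ≤ C) →
      Measurable[completedFiltration ν id c] g → (∃ C : ℝ, ∀ ω, ‖g ω‖ ≤ C) →
      ∫ ω, inner ℝ (f ω) (β ω b - β ω a) * inner ℝ (g ω) (β ω d - β ω c) ∂ν =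
        (volume : Measure I).real (Set.Ioc a b ∩ Set.Ioc c d) *
          ∫ ω, inner ℝ (f ω) (g ω) ∂ν := by
    intro a b c d f g hab hbc hcd hf hfb hg hgb
    have hvol : Set.Ioc a b ∩ Set.Ioc c d = ∅ := by
      ext s
      simp only [Set.mem_inter_iff, Set.mem_Ioc, Set.mem_empty_iff_false, iff_false]
      rintro ⟨⟨-, h1⟩, ⟨h2, -⟩⟩
      exact absurd (h2.trans_le (h1.trans hbc)) (lt_irrefl _)
    rw [hvol]
    simp only [measureReal_empty, zero_mul]
    have hm : Measurable[completedFiltration ν id c]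
        fun ω => (inner ℝ (f ω) (β ω b - β ω a) : ℝ) • g ω := by
      refine Measurable.smul (f := fun ω => (inner ℝ (f ω) (β ω b - β ω a) : ℝ)) ?_ hg
      exact (mono (hab.trans hbc) hf).inner ((measurable_brownian hfilt hbc).sub
        (measurable_brownian hfilt (hab.trans hbc)))
    obtain ⟨D, hD⟩ := hgb
    have hi : Integrable (fun ω => (inner ℝ (f ω) (β ω b - β ω a) : ℝ) • g ω) ν := by
      refine Integrable.smul_bdd (C := D) ((hL2 hab hf hfb).integrable one_le_two)
        (aemeasurable_of_completedFiltration hg).aestronglyMeasurable (ae_of_all _ hD)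
    have := hβ.integral_inner_increment hfilt hcd hm hi
    simpa only [real_inner_smul_left] using this
  have split : ∀ {a m b c d : I} {f g : PathSpace n → State n}, a ≤ m → m ≤ b → c ≤ d →
      Measurable[completedFiltration ν id a] f → (∃ C : ℝ, ∀ ω, ‖f ω‖ ≤ C) →
      Measurable[completedFiltration ν id c] g → (∃ C : ℝ, ∀ ω, ‖g ω‖ ≤ C) →
      ∫ ω, inner ℝ (f ω) (β ω m - β ω a) * inner ℝ (g ω) (β ω d - β ω c) ∂ν =
        (volume : Measure I).real (Set.Ioc a m ∩ Set.Ioc c d) * ∫ ω, inner ℝ (f ω) (g ω) ∂ν →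
      ∫ ω, inner ℝ (f ω) (β ω b - β ω m) * inner ℝ (g ω) (β ω d - β ω c) ∂ν =
        (volume : Measure I).real (Set.Ioc m b ∩ Set.Ioc c d) * ∫ ω, inner ℝ (f ω) (g ω) ∂ν →
      ∫ ω, inner ℝ (f ω) (β ω b - β ω a) * inner ℝ (g ω) (β ω d - β ω c) ∂ν =
        (volume : Measure I).real (Set.Ioc a b ∩ Set.Ioc c d) *
          ∫ ω, inner ℝ (f ω) (g ω) ∂ν := by
    intro a m b c d f g ham hmb hcd hf hfb hg hgb h1 h2
    have hvol : (volume : Measure I).real (Set.Ioc a b ∩ Set.Ioc c d) =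
        (volume : Measure I).real (Set.Ioc a m ∩ Set.Ioc c d) +
          (volume : Measure I).real (Set.Ioc m b ∩ Set.Ioc c d) := by
      rw [← Set.Ioc_union_Ioc_eq_Ioc ham hmb, Set.union_inter_distrib_right,
        measureReal_union _ (measurableSet_Ioc.inter measurableSet_Ioc)]
      refine Set.disjoint_left.2 fun s hs hs' => ?_
      exact absurd (hs'.1.1.trans_le hs.1.2) (lt_irrefl _)
    rw [hvol, add_mul, ← h1, ← h2]
    refine Eq.trans ?_ (integral_add ((hL2 ham hf hfb).integrable_mul (hL2 hcd hg hgb))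
      ((hL2 hmb (mono ham hf) hfb).integrable_mul (hL2 hcd hg hgb)))
    refine integral_congr_ae (ae_of_all _ fun ω => ?_)
    simp only [← add_mul, ← inner_add_right]
    congr 2
    abel
  have symm : ∀ {a b c d : I} {f g : PathSpace n → State n},
      ∫ ω, inner ℝ (f ω) (β ω b - β ω a) * inner ℝ (g ω) (β ω d - β ω c) ∂ν =
        (volume : Measure I).real (Set.Ioc a b ∩ Set.Ioc c d) * ∫ ω, inner ℝ (f ω) (g ω) ∂ν →
      ∫ ω, inner ℝ (g ω) (β ω d - β ω c) * inner ℝ (f ω) (β ω b - β ω a) ∂ν =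
        (volume : Measure I).real (Set.Ioc c d ∩ Set.Ioc a b) *
          ∫ ω, inner ℝ (g ω) (f ω) ∂ν := by
    intro a b c d f g h
    rw [Set.inter_comm]
    simpa only [mul_comm (inner ℝ (g _) (β _ d - β _ c)), real_inner_comm] using h
  have left : ∀ {a b d : I} {f g : PathSpace n → State n}, a ≤ b → b ≤ d →
      Measurable[completedFiltration ν id a] f → (∃ C : ℝ, ∀ ω, ‖f ω‖ ≤ C) →
      Measurable[completedFiltration ν id a] g → (∃ C : ℝ, ∀ ω, ‖g ω‖ ≤ C) →
      ∫ ω, inner ℝ (f ω) (β ω b - β ω a) * inner ℝ (g ω) (β ω d - β ω a) ∂ν =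
        (volume : Measure I).real (Set.Ioc a b ∩ Set.Ioc a d) *
          ∫ ω, inner ℝ (f ω) (g ω) ∂ν := by
    intro a b d f g hab hbd hf hfb hg hgb
    refine symm (split hab hbd hab hg hgb hf hfb ?_ ?_)
    · rw [Set.inter_self, volume_real_Ioc hab]
      exact hβ.integral_inner_mul_inner hfilt hab hg hgb hf hfb
    · exact symm (disj hab le_rfl hbd hf hfb (mono hab hg) hgb)
  have main : ∀ {a b c d : I} {f g : PathSpace n → State n}, a ≤ b → c ≤ d → a ≤ c →
      Measurable[completedFiltration ν id a] f → (∃ C : ℝ, ∀ ω, ‖f ω‖ ≤ C) →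
      Measurable[completedFiltration ν id c] g → (∃ C : ℝ, ∀ ω, ‖g ω‖ ≤ C) →
      ∫ ω, inner ℝ (f ω) (β ω b - β ω a) * inner ℝ (g ω) (β ω d - β ω c) ∂ν =
        (volume : Measure I).real (Set.Ioc a b ∩ Set.Ioc c d) *
          ∫ ω, inner ℝ (f ω) (g ω) ∂ν := by
    intro a b c d f g hab hcd hac hf hfb hg hgb
    rcases le_total b c with hbc | hcb
    · exact disj hab hbc hcd hf hfb hg hgb
    · refine split hac hcb hcd hf hfb hg hgb (disj hac le_rfl hcd hf hfb hg hgb) ?_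
      rcases le_total b d with hbd | hdb
      · exact left hcb hbd (mono hac hf) hfb hg hgb
      · exact symm (left hcd hdb hg hgb (mono hac hf) hfb)
  rcases le_total a c with hac | hca
  · exact main hab hcd hac hf hfb hg hgb
  · exact symm (main hcd hab hca hg hgb hf hfb)

variable (ν β) in
/-- The pairs formed by an integrand `ξ 1_{(a, b]}`, with `ξ` bounded and `ℱ_a`-measurable, and its
integral `⟨ξ, β_b - β_a⟩`. -/
def elementaryIntegrals : Set (Lp (CM n) 2 ν × Lp ℝ 2 ν) :=
  {p | ∃ (a b : I) (ξ : PathSpace n → State n), a ≤ b ∧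
    Measurable[completedFiltration ν id a] ξ ∧ (∃ C : ℝ, ∀ ω, ‖ξ ω‖ ≤ C) ∧
    p.1 =ᵐ[ν] (fun ω => stepCM a b (ξ ω)) ∧
    p.2 =ᵐ[ν] fun ω => inner ℝ (ξ ω) (β ω b - β ω a)}

variable (ν β) in
/-- The graph of the Itô integral: the closed span of the elementary integrals. -/
noncomputable def itoGraph : Submodule ℝ (Lp (CM n) 2 ν × Lp ℝ 2 ν) :=
  (Submodule.span ℝ (elementaryIntegrals ν β)).topologicalClosure

/-- Itô's isometry. -/
theorem inner_fst_eq_inner_snd_of_mem_itoGraph (hβ : IsBrownianMotion ν β)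
    (hfilt : ∀ t, completedFiltration ν β t = completedFiltration ν id t)
    {p q : Lp (CM n) 2 ν × Lp ℝ 2 ν} (hp : p ∈ itoGraph ν β) (hq : q ∈ itoGraph ν β) :
    inner ℝ p.1 q.1 = inner ℝ p.2 q.2 := by
  have hgen : ∀ p ∈ elementaryIntegrals ν β, ∀ q ∈ elementaryIntegrals ν β,
      inner ℝ p.1 q.1 = inner ℝ p.2 q.2 := by
    rintro p ⟨a, b, ξ, hab, hξ, hξb, hp1, hp2⟩ q ⟨c, d, η, hcd, hη, hηb, hq1, hq2⟩
    have h := hβ.integral_inner_mul_inner_Ioc hfilt hab hcd hξ hξb hη hηb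
    rw [L2.inner_def, L2.inner_def]
    have h1 : ∫ ω, inner ℝ (p.1 ω) (q.1 ω) ∂ν =
        ∫ ω, (volume : Measure I).real (Set.Ioc a b ∩ Set.Ioc c d) * inner ℝ (ξ ω) (η ω) ∂ν := by
      refine integral_congr_ae ?_
      filter_upwards [hp1, hq1] with ω h1 h2
      rw [h1, h2, inner_stepCM_stepCM]
    have h2 : ∫ ω, inner ℝ (p.2 ω) (q.2 ω) ∂ν =
        ∫ ω, inner ℝ (ξ ω) (β ω b - β ω a) * inner ℝ (η ω) (β ω d - β ω c) ∂ν := by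
      refine integral_congr_ae ?_
      filter_upwards [hp2, hq2] with ω h1 h2
      rw [h1, h2]
      simp [mul_comm]
    rw [h1, h2, integral_const_mul, h]
  have hspan₁ : ∀ p ∈ Submodule.span ℝ (elementaryIntegrals ν β),
      ∀ q ∈ elementaryIntegrals ν β, inner ℝ p.1 q.1 = inner ℝ p.2 q.2 := by
    intro p hp q hq
    induction hp using Submodule.span_induction with
    | mem x hx => exact hgen x hx q hq
    | zero => simp
    | add x y _ _ hx hy => simp only [Prod.fst_add, Prod.snd_add, inner_add_left, hx, hy]
    | smul r x _ hx => simp only [Prod.smul_fst, Prod.smul_snd, real_inner_smul_left, hx]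
  have hspan : ∀ p ∈ Submodule.span ℝ (elementaryIntegrals ν β),
      ∀ q ∈ Submodule.span ℝ (elementaryIntegrals ν β), inner ℝ p.1 q.1 = inner ℝ p.2 q.2 := by
    intro p hp q hq
    induction hq using Submodule.span_induction with
    | mem x hx => exact hspan₁ p hp x hx
    | zero => simp
    | add x y _ _ hx hy => simp only [Prod.fst_add, Prod.snd_add, inner_add_right, hx, hy]
    | smul r x _ hx => simp only [Prod.smul_fst, Prod.smul_snd, real_inner_smul_right, hx]
  -- The identity is closed in each variable separately, so it extends to the closure one variable
  -- at a time.
  have hcl₁ : ∀ p ∈ Submodule.span ℝ (elementaryIntegrals ν β), ∀ q ∈ itoGraph ν β,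
      inner ℝ p.1 q.1 = inner ℝ p.2 q.2 := by
    intro p hp q hq
    have hc : IsClosed {q : Lp (CM n) 2 ν × Lp ℝ 2 ν | inner ℝ p.1 q.1 = inner ℝ p.2 q.2} :=
      isClosed_eq (by fun_prop) (by fun_prop)
    exact closure_minimal (fun q hq => hspan p hp q hq) hc hq
  have hc : IsClosed {p : Lp (CM n) 2 ν × Lp ℝ 2 ν | inner ℝ p.1 q.1 = inner ℝ p.2 q.2} :=
    isClosed_eq (by fun_prop) (by fun_prop)
  exact closure_minimal (fun p hp => hcl₁ p hp q hq) hc hp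

theorem norm_fst_eq_norm_snd_of_mem_itoGraph (hβ : IsBrownianMotion ν β)
    (hfilt : ∀ t, completedFiltration ν β t = completedFiltration ν id t)
    {p : Lp (CM n) 2 ν × Lp ℝ 2 ν} (hp : p ∈ itoGraph ν β) : ‖p.1‖ = ‖p.2‖ := by
  have h := inner_fst_eq_inner_snd_of_mem_itoGraph hβ hfilt hp hp
  rw [real_inner_self_eq_norm_sq, real_inner_self_eq_norm_sq] at h
  exact (pow_left_inj₀ (norm_nonneg _) (norm_nonneg _) two_ne_zero).1 h

/-- The isometry forces the difference `(0, J - J')` to vanish. As `stochInt` is an arbitrary choice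
of version, its additivity is obtained by placing both sides in the graph over one integrand. -/
theorem snd_unique_of_mem_itoGraph (hβ : IsBrownianMotion ν β)
    (hfilt : ∀ t, completedFiltration ν β t = completedFiltration ν id t)
    {f : Lp (CM n) 2 ν} {J J' : Lp ℝ 2 ν} (h : (f, J) ∈ itoGraph ν β)
    (h' : (f, J') ∈ itoGraph ν β) : J = J' := by
  have := norm_fst_eq_norm_snd_of_mem_itoGraph hβ hfilt ((itoGraph ν β).sub_mem h h')
  simp only [Prod.mk_sub_mk, sub_self, norm_zero] at this
  exact sub_eq_zero.1 (norm_eq_zero.1 this.symm)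

end ItoIsometry

/-! ### Time integrals of adapted processes. -/

section AdaptedIntegral

variable {n : ℕ} {ν : Measure (PathSpace n)} [IsProbabilityMeasure ν]

/-- The time integral of a jointly measurable bounded process whose values are measurable with
respect to a completed `σ`-algebra is again measurable with respect to it. Real-valued case. -/
theorem measurable_setIntegral_real {t : I} {T : Set I} (hT : MeasurableSet T)
    {U : I → PathSpace n → ℝ} (hU : Measurable (Function.uncurry U))
    (hUt : ∀ s ∈ T, Measurable[completedFiltration ν id t] (U s)) {C : ℝ}
    (hC : ∀ s ω, ‖U s ω‖ ≤ C) :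
    Measurable[completedFiltration ν id t] fun ω => ∫ s in T, U s ω := by
  have hm : rawFiltration n t ≤ instMeasurableSpacePathSpace n := rawFiltration_le t
  set Y : PathSpace n → ℝ := fun ω => ∫ s in T, U s ω with hY
  have hYm : StronglyMeasurable Y := hU.stronglyMeasurable.integral_prod_left
  have hYb : ∀ ω, ‖Y ω‖ ≤ C * (volume : Measure I).real T := fun ω =>
    norm_setIntegral_le_of_norm_le_const (measure_lt_top _ _) fun s _ => hC s ω
  have hY2 : MemLp Y 2 ν := MemLp.of_bound hYm.aestronglyMeasurable _ (ae_of_all _ hYb)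
  -- It suffices that `Y` equal its conditional expectation `E` almost surely. The residual `Y - E`
  -- is orthogonal to every `U s`, hence by Fubini to `Y`, and it is orthogonal to `E`; so its
  -- square integrates to zero. No joint measurability with respect to the completed σ-algebra is
  -- required.
  set E : PathSpace n → ℝ := ν[Y | rawFiltration n t] with hE
  have hE2 : MemLp E 2 ν := hY2.condExp one_le_two
  have hEm : StronglyMeasurable[rawFiltration n t] E := stronglyMeasurable_condExp
  have hYi := hY2.integrable one_le_two
  have hR2 : MemLp (fun ω => Y ω - E ω) 2 ν := hY2.sub hE2
  have hRi := hR2.integrable one_le_two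
  have horth : ∀ g : PathSpace n → ℝ, AEStronglyMeasurable[rawFiltration n t] g ν →
      MemLp g 2 ν → ∫ ω, g ω * (Y ω - E ω) ∂ν = 0 := by
    intro g hg hg2
    have h1 : ∫ ω, g ω * Y ω ∂ν = ∫ ω, g ω * E ω ∂ν := by
      have h := condExp_mul_of_aestronglyMeasurable_left hg (hg2.integrable_mul hY2) hYi
      calc ∫ ω, g ω * Y ω ∂ν = ∫ ω, (ν[g * Y | rawFiltration n t]) ω ∂ν := (integral_condExp hm).symm
        _ = ∫ ω, g ω * E ω ∂ν := integral_congr_ae h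
    simp only [mul_sub]
    refine (integral_sub (hg2.integrable_mul hY2) (hg2.integrable_mul hE2)).trans ?_
    exact sub_eq_zero.2 h1
  have hUR : ∀ s ∈ T, ∫ ω, U s ω * (Y ω - E ω) ∂ν = 0 := by
    intro s hs
    obtain ⟨g, hg, hgU⟩ := exists_measurable_eventuallyEq (hUt s hs)
    refine horth _ ⟨g, hg.stronglyMeasurable, hgU⟩ ?_
    exact MemLp.of_bound (hU.of_uncurry_left).aestronglyMeasurable C (ae_of_all _ (hC s))
  have hYR : ∫ ω, Y ω * (Y ω - E ω) ∂ν = 0 := by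
    have hint : Integrable (Function.uncurry fun ω s => U s ω * (Y ω - E ω))
        (ν.prod (volume.restrict T)) := by
      refine Integrable.bdd_mul (c := C) (hRi.comp_fst (volume.restrict T)) ?_ ?_
      · exact (hU.comp measurable_swap).aestronglyMeasurable
      · exact ae_of_all _ fun p => hC p.2 p.1
    calc ∫ ω, Y ω * (Y ω - E ω) ∂ν
        = ∫ ω, (∫ s in T, U s ω * (Y ω - E ω)) ∂ν := by
          simp only [integral_mul_const, hY]
      _ = ∫ s in T, (∫ ω, U s ω * (Y ω - E ω) ∂ν) := integral_integral_swap hint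
      _ = ∫ s in T, (0 : ℝ) := setIntegral_congr_fun hT hUR
      _ = 0 := by simp
  have hER := horth E hEm.aestronglyMeasurable hE2
  have hsq : ∫ ω, (Y ω - E ω) ^ 2 ∂ν = 0 := by
    have h1 : ∀ ω, (Y ω - E ω) ^ 2 = Y ω * (Y ω - E ω) - E ω * (Y ω - E ω) := fun ω => by ring
    simp only [h1]
    refine (integral_sub (hY2.integrable_mul hR2) (hE2.integrable_mul hR2)).trans ?_
    exact sub_eq_zero.2 (hYR.trans hER.symm)
  have hzero : (fun ω => (Y ω - E ω) ^ 2) =ᵐ[ν] 0 :=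
    (integral_eq_zero_iff_of_nonneg (fun ω => sq_nonneg _) hR2.integrable_sq).1 hsq
  have hYE : Y =ᵐ[ν] E := by
    filter_upwards [hzero] with ω hω
    exact sub_eq_zero.1 (pow_eq_zero_iff two_ne_zero |>.1 hω)
  exact measurable_completedFiltration_congr
    (hEm.measurable.mono le_eventuallyMeasurableSpace le_rfl) hYE

theorem measurable_state_of_apply {Ω : Type*} {m : MeasurableSpace Ω} {f : Ω → State n}
    (hf : ∀ i, Measurable fun ω => f ω i) : Measurable f :=
  (MeasurableEquiv.toLp 2 (Fin n → ℝ)).measurable.comp (measurable_pi_lambda _ hf)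

/-- The time integral of a jointly measurable bounded process whose values are measurable with
respect to a completed `σ`-algebra is again measurable with respect to it. -/
theorem measurable_setIntegral {t : I} {T : Set I} (hT : MeasurableSet T)
    {U : I → PathSpace n → State n} (hU : Measurable (Function.uncurry U))
    (hUt : ∀ s ∈ T, Measurable[completedFiltration ν id t] (U s)) {C : ℝ}
    (hC : ∀ s ω, ‖U s ω‖ ≤ C) :
    Measurable[completedFiltration ν id t] fun ω => ∫ s in T, U s ω := by
  refine @measurable_state_of_apply n _ (completedFiltration ν id t) _ fun i => ?_
  have hi : ∀ ω, (∫ s in T, U s ω) i = ∫ s in T, U s ω i := by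
    intro ω
    refine ((EuclideanSpace.proj (𝕜 := ℝ) i).integral_comp_comm (𝕜 := ℝ) ?_).symm
    refine Integrable.of_bound (hU.of_uncurry_right).aestronglyMeasurable C ?_
    exact ae_of_all _ fun s => hC s ω
  simp only [hi]
  refine measurable_setIntegral_real (C := C) hT (U := fun s ω => U s ω i) ?_ ?_ ?_
  · exact (by fun_prop : Measurable fun x : State n => x i).comp hU
  · exact fun s hs => (by fun_prop : Measurable fun x : State n => x i).comp (hUt s hs)
  · exact fun s ω => (PiLp.norm_apply_le _ _).trans (hC s ω)

end AdaptedIntegral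

/-! ### Lebesgue differentiation along a regular grid. -/

section Averages

variable {E : Type*} [NormedAddCommGroup E] [NormedSpace ℝ E] [CompleteSpace E]

/-- The point `k / N` of the unit interval, or `1` when `k > N`. -/
noncomputable def gridPoint (N k : ℕ) : I := Set.projIcc (0 : ℝ) 1 zero_le_one (k / N)

theorem gridPoint_mono (N : ℕ) : Monotone (gridPoint N) := fun _ _ h =>
  Set.monotone_projIcc _ (by gcongr)

theorem coe_gridPoint {N k : ℕ} (hk : k ≤ N) : (gridPoint N k : ℝ) = k / N := by
  rw [gridPoint, Set.coe_projIcc, min_eq_right, max_eq_right]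
  · positivity
  · exact div_le_one_of_le₀ (by exact_mod_cast hk) (by positivity)

/-- Lebesgue differentiation along the intervals that precede a point of a regular grid. -/
theorem ae_tendsto_average_preceding {f : I → E} (hf : Integrable f volume) :
    ∀ᵐ s : I, ∀ k : ℕ → ℕ, (∀ᶠ N in atTop, 1 ≤ k N ∧ k N < N ∧
      s ∈ Set.Ioc (gridPoint N (k N)) (gridPoint N (k N + 1))) →
      Tendsto (fun N : ℕ => (N : ℝ) • ∫ r in Set.Ioc (gridPoint N (k N - 1)) (gridPoint N (k N)),
        f r) atTop (𝓝 (f s)) := by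
  let g : ℝ → E := (I : Set ℝ).indicator fun r => f (Set.projIcc 0 1 zero_le_one r)
  have hgf : ∀ s : I, g s = f s := by
    intro s
    simp only [g, Set.indicator_of_mem s.2]
    congr 1
    exact Set.projIcc_val zero_le_one s
  have hemb : MeasurableEmbedding (Subtype.val : I → ℝ) := MeasurableEmbedding.subtype_coe
    measurableSet_Icc
  have hg : Integrable g volume := by
    rw [integrable_indicator_iff measurableSet_Icc, IntegrableOn,
      ← unitInterval.measurePreserving_coe.integrable_comp_emb hemb]
    refine hf.congr (ae_of_all _ fun s => ?_)
    simp [Set.projIcc_val]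
  -- The balls are the grid intervals preceding `s`, which do not contain `s`. With centre `(k -
  -- 1/2) / N` and radius `1 / (2N)`, tripling the radius reaches exactly `(k + 1) / N ≥ s`; hence
  -- the factor `3`.
  have hae := IsUnifLocDoublingMeasure.ae_tendsto_average (volume : Measure ℝ)
    hg.locallyIntegrable 3
  have hae' : ∀ᵐ s : I, ∀ (w : ℕ → ℝ) (δ : ℕ → ℝ), Tendsto δ atTop (𝓝[>] 0) →
      (∀ᶠ j in atTop, (s : ℝ) ∈ Metric.closedBall (w j) (3 * δ j)) →
      Tendsto (fun j => ⨍ y in Metric.closedBall (w j) (δ j), g y) atTop (𝓝 (g s)) := by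
    have := unitInterval.measurePreserving_coe.quasiMeasurePreserving.ae
      (ae_restrict_of_ae (s := (I : Set ℝ)) hae)
    filter_upwards [this] with s hs w δ h1 h2
    exact hs w δ h1 h2
  filter_upwards [hae'] with s hs k hk
  have hδ : Tendsto (fun N : ℕ => (1 : ℝ) / (2 * N)) atTop (𝓝[>] 0) := by
    rw [tendsto_nhdsWithin_iff]
    constructor
    · have := tendsto_one_div_atTop_nhds_zero_nat (𝕜 := ℝ) |>.const_mul (1 / 2)
      refine (this.congr fun N => ?_).trans_eq ?_
      · ring
      · simp
    · filter_upwards [eventually_gt_atTop 0] with N hN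
      have : (0 : ℝ) < N := by exact_mod_cast hN
      exact Set.mem_Ioi.2 (by positivity)
  have h := hs (fun N => ((k N : ℝ) - 1 / 2) / N) _ hδ ?_
  · rw [hgf] at h
    refine h.congr' ?_
    filter_upwards [hk, eventually_gt_atTop 0] with N ⟨hk1, hkN, hks⟩ hN
    have hN' : (0 : ℝ) < N := by exact_mod_cast hN
    obtain ⟨j, hj⟩ : ∃ j, k N = j + 1 := ⟨k N - 1, by omega⟩
    rw [Real.closedBall_eq_Icc, hj, setAverage_eq, Nat.add_sub_cancel]
    have h1 : ((j + 1 : ℕ) - 1 / 2 : ℝ) / N - 1 / (2 * N) = j / N := by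
      push_cast; field_simp; ring
    have h2 : ((j + 1 : ℕ) - 1 / 2 : ℝ) / N + 1 / (2 * N) = (j + 1 : ℕ) / N := by
      push_cast; field_simp; ring
    rw [h1, h2, integral_Icc_eq_integral_Ioc]
    have hvol : (volume : Measure ℝ).real (Set.Icc ((j : ℝ) / N) ((j + 1 : ℕ) / N)) = (N : ℝ)⁻¹ := by
      rw [Real.volume_real_Icc_of_le (by gcongr; simp)]
      push_cast; field_simp; ring
    rw [hvol, inv_inv]
    congr 1
    have hsub : Set.Ioc ((j : ℝ) / N) ((j + 1 : ℕ) / N) ⊆ I := by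
      intro r hr
      refine ⟨(by positivity : (0 : ℝ) ≤ j / N).trans hr.1.le, hr.2.trans ?_⟩
      exact div_le_one_of_le₀ (by exact_mod_cast (by omega)) hN'.le
    have hpre : Set.Ioc (gridPoint N j) (gridPoint N (j + 1)) =
        Subtype.val ⁻¹' Set.Ioc ((j : ℝ) / N) ((j + 1 : ℕ) / N) := by
      ext r
      rw [Set.mem_preimage, Set.mem_Ioc, Set.mem_Ioc, ← coe_gridPoint (by omega : j ≤ N),
        ← coe_gridPoint (by omega : j + 1 ≤ N)]
      rfl
    rw [hpre]
    have := unitInterval.measurePreserving_coe.setIntegral_preimage_emb hemb g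
      (Set.Ioc ((j : ℝ) / N) ((j + 1 : ℕ) / N))
    simp only [hgf] at this
    rw [this, Measure.restrict_restrict measurableSet_Ioc, Set.inter_eq_left.2 hsub]
  · filter_upwards [hk, eventually_gt_atTop 0] with N ⟨hk1, hkN, hks⟩ hN
    have hN' : (0 : ℝ) < N := by exact_mod_cast hN
    have h1 : (k N : ℝ) / N < s := by
      rw [← coe_gridPoint hkN.le]; exact hks.1
    have h2 : (s : ℝ) ≤ (k N + 1 : ℕ) / N := by
      rw [← coe_gridPoint hkN]; exact hks.2
    rw [Real.closedBall_eq_Icc]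
    push_cast at h2
    have e1 : ((k N : ℝ) - 1 / 2) / N = k N / N - 1 / (2 * N) := by field_simp
    have e2 : ((k N : ℝ) + 1) / N = k N / N + 2 * (1 / (2 * N)) := by field_simp
    have h3 : (0 : ℝ) < 1 / (2 * N) := by positivity
    constructor <;> rw [e1] <;> linarith

/-- Every positive time eventually lies in an interval of the grid other than the first one. -/
theorem exists_eventually_mem_grid {s : I} (hs : 0 < s) :
    ∃ k : ℕ → ℕ, ∀ᶠ N in atTop, 1 ≤ k N ∧ k N < N ∧
      s ∈ Set.Ioc (gridPoint N (k N)) (gridPoint N (k N + 1)) := by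
  have hs' : (0 : ℝ) < s := hs
  refine ⟨fun N => ⌈(s : ℝ) * N⌉₊ - 1, ?_⟩
  have hev : ∀ᶠ N : ℕ in atTop, 1 < (s : ℝ) * N := by
    have : Tendsto (fun N : ℕ => (s : ℝ) * N) atTop atTop :=
      Tendsto.const_mul_atTop hs' tendsto_natCast_atTop_atTop
    exact this.eventually_gt_atTop 1
  filter_upwards [hev, eventually_gt_atTop 0] with N h1 hN
  have hN' : (0 : ℝ) < N := by exact_mod_cast hN
  have h2 : 1 < ⌈(s : ℝ) * N⌉₊ := Nat.lt_ceil.2 (by simpa using h1)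
  have h3 : ⌈(s : ℝ) * N⌉₊ ≤ N := Nat.ceil_le.2 (by nlinarith [s.2.2])
  obtain ⟨j, hj⟩ : ∃ j, ⌈(s : ℝ) * N⌉₊ = j + 1 := ⟨⌈(s : ℝ) * N⌉₊ - 1, by omega⟩
  have h4 : (s : ℝ) * N ≤ j + 1 := by
    have := Nat.le_ceil ((s : ℝ) * N)
    rw [hj] at this
    exact_mod_cast this
  have h5 : (j : ℝ) < s * N := Nat.lt_ceil.1 (by omega)
  rw [hj, Nat.add_sub_cancel]
  refine ⟨by omega, by omega, ?_, ?_⟩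
  · rw [← Subtype.coe_lt_coe, coe_gridPoint (by omega), div_lt_iff₀ hN']
    exact h5
  · rw [← Subtype.coe_le_coe, coe_gridPoint (by omega), le_div_iff₀ hN']
    push_cast
    exact h4

end Averages

/-! ### Approximation of bounded adapted processes by simple ones. -/

section Approximation

variable {n : ℕ} {ν : Measure (PathSpace n)}

theorem SimpleProcess.eval_of_mem (S : SimpleProcess ν) {k : ℕ} (hk : k < S.N) {s : I}
    (hs : s ∈ Set.Ioc (S.time k) (S.time (k + 1))) (ω : PathSpace n) :
    S.eval ω s = S.coef k ω := by
  rw [SimpleProcess.eval, Finset.sum_eq_single_of_mem k (Finset.mem_range.2 hk)]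
  · rw [Set.indicator_of_mem hs]
  · intro i _ hik
    refine Set.indicator_of_notMem (fun hi => ?_) _
    rcases lt_or_gt_of_ne hik with h | h
    · exact absurd (hs.1.trans_le (hi.2.trans (S.mono h))) (lt_irrefl _)
    · exact absurd (hi.1.trans_le (hs.2.trans (S.mono h))) (lt_irrefl _)

theorem SimpleProcess.norm_eval_le (S : SimpleProcess ν) {C : ℝ} (hC0 : 0 ≤ C)
    (hC : ∀ k ω, ‖S.coef k ω‖ ≤ C) (ω : PathSpace n) (s : I) : ‖S.eval ω s‖ ≤ C := by
  by_cases h : ∃ k < S.N, s ∈ Set.Ioc (S.time k) (S.time (k + 1))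
  · obtain ⟨k, hk, hs⟩ := h
    rw [S.eval_of_mem hk hs]
    exact hC k ω
  · push Not at h
    rw [SimpleProcess.eval, Finset.sum_eq_zero fun k hk =>
      Set.indicator_of_notMem (h k (Finset.mem_range.1 hk)) _, norm_zero]
    exact hC0

theorem SimpleProcess.measurable_eval (S : SimpleProcess ν) (hS : ∀ k, Measurable (S.coef k)) :
    Measurable (Function.uncurry S.eval) := by
  have : Function.uncurry S.eval = fun p : PathSpace n × I => ∑ i ∈ Finset.range S.N,
      (Prod.snd ⁻¹' Set.Ioc (S.time i) (S.time (i + 1))).indicator (fun p => S.coef i p.1) p := by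
    funext p
    rfl
  rw [this]
  exact Finset.measurable_fun_sum _ fun i _ =>
    ((hS i).comp measurable_fst).indicator (measurable_snd measurableSet_Ioc)

theorem volume_real_Ioc_gridPoint_le {N : ℕ} (hN : 0 < N) (k : ℕ) :
    (volume : Measure I).real (Set.Ioc (gridPoint N k) (gridPoint N (k + 1))) ≤ (N : ℝ)⁻¹ := by
  rw [volume_real_Ioc (gridPoint_mono N k.le_succ)]
  have hN' : (0 : ℝ) < N := by exact_mod_cast hN
  have h : ∀ j : ℕ, (gridPoint N j : ℝ) = min 1 ((j : ℝ) / N) := by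
    intro j
    rw [gridPoint, Set.coe_projIcc, max_eq_right]
    exact le_min zero_le_one (by positivity)
  have h1 : ((k + 1 : ℕ) : ℝ) / N = k / N + (N : ℝ)⁻¹ := by push_cast; field_simp
  have h2 : (0 : ℝ) < (N : ℝ)⁻¹ := by positivity
  rw [h, h, h1]
  rcases le_total 1 ((k : ℝ) / N) with h3 | h3
  · rw [min_eq_left h3, min_eq_left (by linarith)]
    linarith
  · rw [min_eq_right h3]
    linarith [min_le_right 1 ((k : ℝ) / N + (N : ℝ)⁻¹)]

variable [IsProbabilityMeasure ν]

/-- The simple process whose value on an interval of the regular grid of step `1 / N` is the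
average of `U` over the previous interval. -/
noncomputable def averageProcess {U : I → PathSpace n → State n} {C : ℝ}
    (hU : Measurable (Function.uncurry U))
    (hUt : ∀ s, Measurable[completedFiltration ν id s] (U s))
    (hC : ∀ s ω, ‖U s ω‖ ≤ C) (N : ℕ) : SimpleProcess ν where
  N := N
  time := gridPoint N
  mono := gridPoint_mono N
  -- Averaging over the preceding interval makes the value known at its left endpoint. For `k = 0`
  -- truncated subtraction gives an empty interval and the value `0`.
  coef k ω := (N : ℝ) • ∫ r in Set.Ioc (gridPoint N (k - 1)) (gridPoint N k), U r ω
  adapted k := by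
    refine Measurable.const_smul ?_ (N : ℝ)
    exact measurable_setIntegral measurableSet_Ioc hU
      (fun s hs => (hUt s).mono (completedFiltration_mono id hs.2) le_rfl) hC
  bounded := ⟨N * (C * 1), fun k ω => by
    rw [norm_smul, Real.norm_natCast]
    have hC0 : 0 ≤ C := (norm_nonneg _).trans (hC 0 ω)
    gcongr
    refine (norm_setIntegral_le_of_norm_le_const (measure_lt_top _ _) fun s _ => hC s ω).trans ?_
    gcongr
    exact measureReal_le_one⟩

variable {U : I → PathSpace n → State n} {C : ℝ} (hU : Measurable (Function.uncurry U))
  (hUt : ∀ s, Measurable[completedFiltration ν id s] (U s)) (hC : ∀ s ω, ‖U s ω‖ ≤ C)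

/-- Unlike the bound stored in `averageProcess`, this one does not depend on `N`, as dominated
convergence requires. -/
theorem norm_averageProcess_coef_le (N k : ℕ) (ω : PathSpace n) :
    ‖(averageProcess hU hUt hC N).coef k ω‖ ≤ C := by
  have hC0 : 0 ≤ C := (norm_nonneg _).trans (hC 0 ω)
  rcases Nat.eq_zero_or_pos N with rfl | hN
  · simpa [averageProcess] using hC0
  have hN' : (0 : ℝ) < N := by exact_mod_cast hN
  change ‖(N : ℝ) • ∫ r in Set.Ioc (gridPoint N (k - 1)) (gridPoint N k), U r ω‖ ≤ C
  rcases k with _ | k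
  · simpa using hC0
  rw [norm_smul, Real.norm_natCast, Nat.add_sub_cancel]
  calc (N : ℝ) * ‖∫ r in Set.Ioc (gridPoint N k) (gridPoint N (k + 1)), U r ω‖
      ≤ N * (C * (N : ℝ)⁻¹) := by
        gcongr
        refine (norm_setIntegral_le_of_norm_le_const (measure_lt_top _ _)
          fun s _ => hC s ω).trans ?_
        gcongr
        exact volume_real_Ioc_gridPoint_le hN k
    _ = C := by field_simp

theorem measurable_averageProcess_coef (N k : ℕ) :
    Measurable ((averageProcess hU hUt hC N).coef k) := by
  refine Measurable.const_smul ?_ (N : ℝ)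
  exact (hU.stronglyMeasurable.integral_prod_left
    (μ := volume.restrict (Set.Ioc (gridPoint N (k - 1)) (gridPoint N k)))).measurable

theorem ae_tendsto_averageProcess (ω : PathSpace n) :
    ∀ᵐ s : I, Tendsto (fun N => (averageProcess hU hUt hC N).eval ω s) atTop (𝓝 (U s ω)) := by
  have hint : Integrable (fun s => U s ω) (volume : Measure I) :=
    Integrable.of_bound (hU.of_uncurry_right).aestronglyMeasurable C (ae_of_all _ fun s => hC s ω)
  have h0 : ∀ᵐ s : I, 0 < s := by
    have : ∀ᵐ s : I, s ≠ 0 := by simp [ae_iff]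
    filter_upwards [this] with s hs
    exact unitInterval.pos_iff_ne_zero.2 hs
  filter_upwards [ae_tendsto_average_preceding hint, h0] with s hs hs0
  obtain ⟨k, hk⟩ := exists_eventually_mem_grid hs0
  refine (hs k hk).congr' ?_
  filter_upwards [hk] with N ⟨_, hkN, hks⟩
  exact ((averageProcess hU hUt hC N).eval_of_mem hkN hks ω).symm

theorem tendsto_averageProcess :
    Tendsto (fun N => ∫⁻ ω, ∫⁻ s : I, ‖(averageProcess hU hUt hC N).eval ω s - U s ω‖ₑ ^ 2
      ∂volume ∂ν) atTop (𝓝 0) := by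
  have hmeas : ∀ N, Measurable (Function.uncurry fun ω s =>
      ‖(averageProcess hU hUt hC N).eval ω s - U s ω‖ₑ ^ 2) := by
    intro N
    have h1 := (averageProcess hU hUt hC N).measurable_eval
      (measurable_averageProcess_coef hU hUt hC N)
    exact ((h1.sub (hU.comp measurable_swap)).enorm).pow_const 2
  have hbound : ∀ N ω s, ‖(averageProcess hU hUt hC N).eval ω s - U s ω‖ₑ ^ 2 ≤
      ENNReal.ofReal (2 * C) ^ 2 := by
    intro N ω s
    have hC0 : 0 ≤ C := (norm_nonneg _).trans (hC s ω)
    gcongr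
    rw [← ofReal_norm]
    refine ENNReal.ofReal_le_ofReal ((norm_sub_le _ _).trans ?_)
    have := (averageProcess hU hUt hC N).norm_eval_le hC0
      (norm_averageProcess_coef_le hU hUt hC N) ω s
    linarith [hC s ω]
  have hfin : ENNReal.ofReal (2 * C) ^ 2 ≠ ∞ := ENNReal.pow_ne_top ENNReal.ofReal_ne_top
  have hinner : ∀ ω, Tendsto (fun N => ∫⁻ s : I,
      ‖(averageProcess hU hUt hC N).eval ω s - U s ω‖ₑ ^ 2) atTop (𝓝 0) := by
    intro ω
    have := tendsto_lintegral_of_dominated_convergence (μ := (volume : Measure I))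
      (F := fun N s => ‖(averageProcess hU hUt hC N).eval ω s - U s ω‖ₑ ^ 2) (f := fun _ => 0)
      (fun _ => ENNReal.ofReal (2 * C) ^ 2) (fun N => (hmeas N).of_uncurry_left)
      (fun N => ae_of_all _ (hbound N ω)) (by simpa using hfin) ?_
    · simpa using this
    · filter_upwards [ae_tendsto_averageProcess hU hUt hC ω] with s hs
      have h1 : Tendsto (fun N => (averageProcess hU hUt hC N).eval ω s - U s ω) atTop (𝓝 0) := by
        simpa using hs.sub_const (U s ω)
      have h2 := ENNReal.Tendsto.pow (n := 2) h1.enorm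
      simpa using h2
  have := tendsto_lintegral_of_dominated_convergence (μ := ν)
    (F := fun N ω => ∫⁻ s : I, ‖(averageProcess hU hUt hC N).eval ω s - U s ω‖ₑ ^ 2)
    (f := fun _ => 0) (fun _ => ENNReal.ofReal (2 * C) ^ 2)
    (fun N => (hmeas N).lintegral_prod_right') (fun N => ae_of_all _ fun ω => ?_)
    (by simpa using hfin) (ae_of_all _ hinner)
  · simpa using this
  · refine (lintegral_mono (hbound N ω)).trans ?_
    simp

end Approximation

/-! ### Existence of the Itô integral on `𝒟`. -/

section Existence

variable {n : ℕ} {ν : Measure (PathSpace n)}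

/-- The density of an element of `𝒟` has a version that is bounded everywhere. -/
theorem exists_bounded_density {u : PathSpace n →ₘ[ν] CM n} (hu : u ∈ boundedShifts ν) :
    ∃ (U : I → PathSpace n → State n) (C : ℝ), Measurable (Function.uncurry U) ∧
      (∀ t, Measurable[completedFiltration ν id t] (U t)) ∧ (∀ s ω, ‖U s ω‖ ≤ C) ∧
      ∀ᵐ ω ∂ν, ∀ᵐ t : I, u ω t = U t ω := by
  obtain ⟨⟨U, hU, hUt, hUu⟩, C, hC⟩ := hu
  have hball : MeasurableSet (Metric.closedBall (0 : State n) (max C 0)) :=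
    Metric.isClosed_closedBall.measurableSet
  -- Truncating the values preserves measurability and adaptedness, and changes the density only on
  -- a null set of times for almost every path.
  let T : State n → State n := (Metric.closedBall (0 : State n) (max C 0)).indicator id
  have hT : Measurable T := measurable_id.indicator hball
  refine ⟨fun t ω => T (U t ω), max C 0, hT.comp hU, fun t => hT.comp (hUt t), ?_, ?_⟩
  · intro s ω
    by_cases h : U s ω ∈ Metric.closedBall (0 : State n) (max C 0)
    · simp only [T, Set.indicator_of_mem h, id]
      simpa using h
    · simp [T, Set.indicator_of_notMem h]
  · filter_upwards [hUu, hC] with ω h1 h2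
    filter_upwards [h1, h2] with t h3 h4
    have : U t ω ∈ Metric.closedBall (0 : State n) (max C 0) := by
      rw [mem_closedBall_zero_iff, ← h3]
      exact h4.trans (le_max_left _ _)
    simp only [T, Set.indicator_of_mem this, id, h3]

theorem enorm_sq_eq_lintegral {α E : Type*} {m : MeasurableSpace α} {μ : Measure α}
    [NormedAddCommGroup E] (f : Lp E 2 μ) : ‖f‖ₑ ^ 2 = ∫⁻ x, ‖f x‖ₑ ^ 2 ∂μ := by
  have := eLpNorm_nnreal_pow_eq_lintegral (f := f) (μ := μ) (p := 2) two_ne_zero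
  rw [Lp.enorm_def]
  simpa using this

/-- The path of a simple process in the Cameron-Martin space. -/
noncomputable def SimpleProcess.toCM (S : SimpleProcess ν) (ω : PathSpace n) : CM n :=
  ∑ i ∈ Finset.range S.N, stepCM (S.time i) (S.time (i + 1)) (S.coef i ω)

theorem SimpleProcess.coeFn_toCM (S : SimpleProcess ν) (ω : PathSpace n) :
    S.toCM ω =ᵐ[volume] S.eval ω := by
  refine (Lp.coeFn_finsetSum _ _).trans ?_
  filter_upwards [(Finset.range S.N).eventually_all.2 fun i _ =>
    coeFn_stepCM (S.time i) (S.time (i + 1)) (S.coef i ω)] with s hs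
  rw [Finset.sum_apply, SimpleProcess.eval]
  exact Finset.sum_congr rfl hs

/-- The distance in `L²(dν × dt)` of a simple process to an element of `L²(ν, H)`. -/
theorem lintegral_simpleProcess_sub {u : PathSpace n →ₘ[ν] CM n} (hu : MemLp u 2 ν)
    {S : SimpleProcess ν} {f : Lp (CM n) 2 ν} (hf : f =ᵐ[ν] S.toCM) :
    ∫⁻ ω, ∫⁻ s : I, ‖S.eval ω s - u ω s‖ₑ ^ 2 ∂volume ∂ν = ‖f - hu.toLp u‖ₑ ^ 2 := by
  rw [enorm_sq_eq_lintegral]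
  refine lintegral_congr_ae ?_
  filter_upwards [Lp.coeFn_sub f (hu.toLp u), hf, hu.coeFn_toLp] with ω h1 h2 h3
  rw [h1, Pi.sub_apply, h2, h3, enorm_sq_eq_lintegral]
  refine lintegral_congr_ae ?_
  filter_upwards [Lp.coeFn_sub (S.toCM ω) (u ω), S.coeFn_toCM ω] with s h4 h5
  rw [h4, Pi.sub_apply, h5]

variable [IsProbabilityMeasure ν]

theorem memLp_of_mem_boundedShifts {u : PathSpace n →ₘ[ν] CM n} (hu : u ∈ boundedShifts ν) :
    MemLp u 2 ν := by
  obtain ⟨-, C, hC⟩ := hu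
  refine MemLp.of_bound u.aestronglyMeasurable (max C 0) ?_
  filter_upwards [hC] with ω hω
  have := Lp.norm_le_of_ae_bound (f := u ω) (C := max C 0) (le_max_right _ _)
    (hω.mono fun t ht => ht.trans (le_max_left _ _))
  simpa [measureUnivNNReal] using this

theorem memLp_stepCM {a b : I} {ξ : PathSpace n → State n} (hξ : AEStronglyMeasurable ξ ν)
    (hb : ∃ C : ℝ, ∀ ω, ‖ξ ω‖ ≤ C) : MemLp (fun ω => stepCM a b (ξ ω)) 2 ν := by
  obtain ⟨C, hC⟩ := hb
  exact (stepCM a b).comp_memLp' (MemLp.of_bound hξ C (ae_of_all _ hC))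

variable {β : PathSpace n → PathSpace n}

/-- Elementary integrals belong to the graph of the Itô integral. -/
theorem IsBrownianMotion.exists_mem_elementaryIntegrals (hβ : IsBrownianMotion ν β) {a b : I}
    (hab : a ≤ b) {ξ : PathSpace n → State n} (hξ : Measurable[completedFiltration ν id a] ξ)
    (hb : ∃ C : ℝ, ∀ ω, ‖ξ ω‖ ≤ C) :
    ∃ p ∈ elementaryIntegrals ν β, p.1 =ᵐ[ν] (fun ω => stepCM a b (ξ ω)) ∧
      p.2 =ᵐ[ν] fun ω => inner ℝ (ξ ω) (β ω b - β ω a) := by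
  have hm := (aemeasurable_of_completedFiltration hξ).aestronglyMeasurable
  have h1 := memLp_stepCM (a := a) (b := b) hm hb
  have h2 := hβ.memLp_inner_increment hab hm hb
  exact ⟨(h1.toLp _, h2.toLp _), ⟨a, b, ξ, hab, hξ, hb, h1.coeFn_toLp, h2.coeFn_toLp⟩,
    h1.coeFn_toLp, h2.coeFn_toLp⟩

theorem IsBrownianMotion.exists_mem_span_simpleProcess (hβ : IsBrownianMotion ν β)
    (S : SimpleProcess ν) :
    ∃ p ∈ Submodule.span ℝ (elementaryIntegrals ν β),
      p.1 =ᵐ[ν] S.toCM ∧ p.2 =ᵐ[ν] S.integral β := by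
  have h := fun i => hβ.exists_mem_elementaryIntegrals (S.mono i.le_succ) (S.adapted i)
    ⟨S.bounded.choose, S.bounded.choose_spec i⟩
  choose p hp hp1 hp2 using h
  refine ⟨∑ i ∈ Finset.range S.N, p i,
    Submodule.sum_mem _ fun i _ => Submodule.subset_span (hp i), ?_, ?_⟩
  · rw [Prod.fst_sum]
    refine (Lp.coeFn_finsetSum _ _).trans ?_
    filter_upwards [(Finset.range S.N).eventually_all.2 fun i _ => hp1 i] with ω hω
    rw [Finset.sum_apply]
    exact Finset.sum_congr rfl hω
  · rw [Prod.snd_sum]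
    refine (Lp.coeFn_finsetSum _ _).trans ?_
    filter_upwards [(Finset.range S.N).eventually_all.2 fun i _ => hp2 i] with ω hω
    rw [Finset.sum_apply]
    exact Finset.sum_congr rfl hω

theorem tendsto_of_enorm_sub_sq {E : Type*} [NormedAddCommGroup E] {f : ℕ → E} {g : E}
    (h : Tendsto (fun k => ‖f k - g‖ₑ ^ 2) atTop (𝓝 0)) : Tendsto f atTop (𝓝 g) := by
  have h1 : Tendsto (fun k => (‖f k - g‖ₑ ^ 2) ^ (1 / 2 : ℝ)) atTop (𝓝 (0 ^ (1 / 2 : ℝ))) :=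
    (ENNReal.continuous_rpow_const.tendsto 0).comp h
  rw [ENNReal.zero_rpow_of_pos (by norm_num)] at h1
  rw [tendsto_iff_edist_tendsto_0]
  refine h1.congr fun k => ?_
  rw [← ENNReal.rpow_natCast, ← ENNReal.rpow_mul, edist_eq_enorm_sub]
  norm_num

/-- An Itô integral is square integrable, and belongs to the graph of the Itô integral. -/
theorem IsItoIntegral.mem_itoGraph (hβ : IsBrownianMotion ν β) {u : PathSpace n →ₘ[ν] CM n}
    (hu : MemLp u 2 ν) {J : PathSpace n → ℝ} (h : IsItoIntegral β u J) :
    ∃ hJ : MemLp J 2 ν, (hu.toLp u, hJ.toLp J) ∈ itoGraph ν β := by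
  obtain ⟨hJm, S, hS, hSJ⟩ := h
  have hp := fun k => hβ.exists_mem_span_simpleProcess (S k)
  choose p hp hp1 hp2 using hp
  have hint : ∀ k, MemLp ((S k).integral β) 2 ν := fun k =>
    (memLp_congr_ae (hp2 k)).1 (Lp.memLp _)
  -- `J` is only assumed measurable; a single simple integral at finite `L²` distance makes it
  -- square integrable.
  have hJ : MemLp J 2 ν := by
    obtain ⟨k, hk⟩ := (hSJ.eventually (gt_mem_nhds zero_lt_one)).exists
    have hd : MemLp (fun ω => (S k).integral β ω - J ω) 2 ν :=
      ⟨(hint k).1.sub hJm, hk.trans ENNReal.one_lt_top⟩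
    have := (hint k).sub hd
    refine (memLp_congr_ae (ae_of_all _ fun ω => ?_)).1 this
    simp
  refine ⟨hJ, ?_⟩
  refine mem_closure_of_tendsto (f := p) (b := atTop) ?_ (Eventually.of_forall hp)
  have h1 : Tendsto (fun k => (p k).1) atTop (𝓝 (hu.toLp u)) := by
    refine tendsto_of_enorm_sub_sq (hS.congr fun k => ?_)
    exact lintegral_simpleProcess_sub hu (hp1 k)
  have h2 : Tendsto (fun k => (p k).2) atTop (𝓝 (hJ.toLp J)) := by
    rw [Lp.tendsto_Lp_iff_tendsto_eLpNorm']
    refine hSJ.congr fun k => eLpNorm_congr_ae ?_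
    filter_upwards [hp2 k, hJ.coeFn_toLp] with ω h3 h4
    rw [Pi.sub_apply, h3, h4]
  exact h1.prodMk_nhds h2

/-- The Itô integral of an element of `𝒟` exists. -/
theorem exists_isItoIntegral (hβ : IsBrownianMotion ν β)
    (hfilt : ∀ t, completedFiltration ν β t = completedFiltration ν id t)
    {u : PathSpace n →ₘ[ν] CM n} (hu : u ∈ boundedShifts ν) : ∃ J, IsItoIntegral β u J := by
  have hu2 := memLp_of_mem_boundedShifts hu
  obtain ⟨U, C, hU, hUt, hC, hUu⟩ := exists_bounded_density hu
  let S := averageProcess hU hUt hC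
  have hS : Tendsto (fun k => ∫⁻ ω, ∫⁻ s : I, ‖(S k).eval ω s - u ω s‖ₑ ^ 2 ∂volume ∂ν)
      atTop (𝓝 0) := by
    refine (tendsto_averageProcess hU hUt hC).congr fun k => lintegral_congr_ae ?_
    filter_upwards [hUu] with ω hω
    refine lintegral_congr_ae ?_
    filter_upwards [hω] with s hs
    rw [hs]
  have hp := fun k => hβ.exists_mem_span_simpleProcess (S k)
  choose p hp hp1 hp2 using hp
  have h1 : Tendsto (fun k => (p k).1) atTop (𝓝 (hu2.toLp u)) := by
    refine tendsto_of_enorm_sub_sq (hS.congr fun k => ?_)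
    exact lintegral_simpleProcess_sub hu2 (hp1 k)
  -- By the isometry, convergence of the integrands makes the integrals Cauchy.
  have hcauchy : CauchySeq fun k => (p k).2 := by
    have h2 := h1.cauchySeq
    rw [Metric.cauchySeq_iff] at h2 ⊢
    intro ε hε
    obtain ⟨N, hN⟩ := h2 ε hε
    refine ⟨N, fun k hk l hl => ?_⟩
    have h3 := norm_fst_eq_norm_snd_of_mem_itoGraph hβ hfilt ((itoGraph ν β).sub_mem
      (subset_closure (hp k)) (subset_closure (hp l)))
    rw [dist_eq_norm, ← Prod.snd_sub, ← h3, Prod.fst_sub, ← dist_eq_norm]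
    exact hN k hk l hl
  obtain ⟨J, hJ⟩ := cauchySeq_tendsto_of_complete hcauchy
  refine ⟨J, (Lp.memLp J).1, S, hS, ?_⟩
  rw [Lp.tendsto_Lp_iff_tendsto_eLpNorm'] at hJ
  refine hJ.congr fun k => eLpNorm_congr_ae ?_
  filter_upwards [hp2 k] with ω h3
  rw [Pi.sub_apply, h3]

/-- On `𝒟` the default value `0` in `stochInt` is never taken. -/
theorem isItoIntegral_stochInt (hβ : IsBrownianMotion ν β)
    (hfilt : ∀ t, completedFiltration ν β t = completedFiltration ν id t)
    {u : PathSpace n →ₘ[ν] CM n} (hu : u ∈ boundedShifts ν) :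
    IsItoIntegral β u (stochInt β u) := by
  have h := exists_isItoIntegral hβ hfilt hu
  rw [stochInt, dif_pos h]
  exact h.choose_spec

end Existence

/-! ### Measures on paths determined by Laplace transforms. -/

section LaplaceTransform

variable {n : ℕ}

/-- Finite measures on the path space with the same finite-dimensional marginals are equal. -/
theorem ext_of_map_finset {P Q : Measure (PathSpace n)} [IsFiniteMeasure P] [IsFiniteMeasure Q]
    (h : ∀ J : Finset I, P.map (fun f (s : J) => f s) = Q.map (fun f (s : J) => f s)) :
    P = Q := by
  have hcoe : Measurable fun (f : PathSpace n) (s : I) => f s :=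
    measurable_pi_lambda _ fun s => measurable_eval s
  have hmap : P.map (fun f (s : I) => f s) = Q.map (fun f (s : I) => f s) := by
    refine IsProjectiveLimit.unique (P := fun J : Finset I => P.map (fun f (s : J) => f s))
      (fun J => ?_) (fun J => ?_)
    · rw [Measure.map_map (Finset.measurable_restrict _) hcoe]
      rfl
    · rw [Measure.map_map (Finset.measurable_restrict _) hcoe]
      exact (h J).symm
  ext D hD
  obtain ⟨E, hE, rfl⟩ : ∃ E, MeasurableSet E ∧
      (fun (f : PathSpace n) (k : ℕ) => f (TopologicalSpace.denseSeq I k)) ⁻¹' E = D := by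
    have := (measurableEmbedding_eval_denseSeq (n := n)).comap_eq
    rw [← this] at hD
    exact hD
  have hr : Measurable fun (g : I → State n) (k : ℕ) => g (TopologicalSpace.denseSeq I k) :=
    measurable_pi_lambda _ fun k => measurable_pi_apply _
  have h1 := congrArg (fun m => m ((fun (g : I → State n) (k : ℕ) =>
    g (TopologicalSpace.denseSeq I k)) ⁻¹' E)) hmap
  simp only [Measure.map_apply hcoe (hr hE)] at h1
  exact h1

/-- A finite measure on the path space is determined by the Laplace transforms of its
finite-dimensional marginals when these are finite. -/
theorem ext_of_lintegral_exp {P Q : Measure (PathSpace n)} [IsFiniteMeasure P]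
    [IsFiniteMeasure Q]
    (hP : ∀ (J : Finset I) (l : I → State n),
      ∫⁻ f, ENNReal.ofReal (Real.exp (∑ s ∈ J, inner ℝ (l s) (f s))) ∂P ≠ ∞)
    (h : ∀ (J : Finset I) (l : I → State n),
      ∫⁻ f, ENNReal.ofReal (Real.exp (∑ s ∈ J, inner ℝ (l s) (f s))) ∂P =
        ∫⁻ f, ENNReal.ofReal (Real.exp (∑ s ∈ J, inner ℝ (l s) (f s))) ∂Q) : P = Q := by
  refine ext_of_map_finset fun J => ?_
  have hJ : Measurable fun (f : PathSpace n) (s : J) => f s :=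
    measurable_pi_lambda _ fun s => measurable_eval _
  refine Measure.ext_of_charFunDual (funext fun L => ?_)
  classical
  -- By Riesz representation, `L` is a sum of inner products with the coordinates, so `X` is `L`
  -- read on the path.
  let l : I → State n := fun s => if hs : s ∈ J then
    (InnerProductSpace.toDual ℝ (State n)).symm (L.comp (.single ℝ (fun _ : J => State n) ⟨s, hs⟩))
    else 0
  let X : PathSpace n → ℝ := fun f => ∑ s ∈ J, inner ℝ (l s) (f s)
  have hX : ∀ f : PathSpace n, L (fun s : J => f s) = X f := by
    intro f
    have h1 : ∀ s : J, inner ℝ (l s) (f s) = L (Pi.single s (f s)) := by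
      intro s
      simp only [l, s.2, dif_pos, InnerProductSpace.toDual_symm_apply]
      rfl
    have h2 : X f = ∑ s : J, inner ℝ (l s) (f s) := (Finset.sum_coe_sort J _).symm
    rw [h2, Finset.sum_congr rfl fun s _ => h1 s, ← map_sum]
    congr 1
    exact (Finset.univ_sum_single (fun s : J => f s)).symm
  have hXm : Measurable X := Finset.measurable_fun_sum _ fun s _ =>
    measurable_const.inner (measurable_eval s)
  have hsmul : ∀ (θ : ℝ) f, θ * X f = ∑ s ∈ J, inner ℝ (θ • l s) (f s) := by
    intro θ f
    simp only [X, Finset.mul_sum, real_inner_smul_left]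
  have hint : ∀ θ : ℝ, Integrable (fun f => Real.exp (θ * X f)) P := by
    intro θ
    refine ⟨(Real.measurable_exp.comp (hXm.const_mul θ)).aestronglyMeasurable, ?_⟩
    rw [hasFiniteIntegral_iff_ofReal (ae_of_all _ fun f => (Real.exp_pos _).le)]
    simp only [hsmul]
    exact (hP J fun s => θ • l s).lt_top
  have hmgf : mgf X P = mgf X Q := by
    funext θ
    rw [mgf, mgf, integral_eq_lintegral_of_nonneg_ae (ae_of_all _ fun f => (Real.exp_pos _).le)
      (Real.measurable_exp.comp (hXm.const_mul θ)).aestronglyMeasurable,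
      integral_eq_lintegral_of_nonneg_ae (ae_of_all _ fun f => (Real.exp_pos _).le)
      (Real.measurable_exp.comp (hXm.const_mul θ)).aestronglyMeasurable]
    simp only [hsmul, h J fun s => θ • l s]
  have hzero : P = 0 ↔ Q = 0 := by
    have := h ∅ 0
    simp only [Finset.sum_empty, Real.exp_zero, ENNReal.ofReal_one, lintegral_const, one_mul] at this
    rw [← Measure.measure_univ_eq_zero, ← Measure.measure_univ_eq_zero, this]
  have hset : integrableExpSet X P = Set.univ := Set.eq_univ_of_forall hint
  -- The moment generating function is finite on all of `ℝ`, so equality extends analytically to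
  -- `ℂ`; its value at `i` is the characteristic function.
  have hc := eqOn_complexMGF_of_mgf' hmgf hzero (x := Complex.I) (by simp [hset])
  rw [charFunDual_apply, charFunDual_apply, integral_map hJ.aemeasurable (by fun_prop),
    integral_map hJ.aemeasurable (by fun_prop)]
  simpa only [complexMGF, hX, mul_comm Complex.I] using hc

end LaplaceTransform

/-! ### Stability of `𝒟` and step shifts. -/

section Shifts

variable {n : ℕ} {ν : Measure (PathSpace n)}

theorem neg_mem_boundedShifts {u : PathSpace n →ₘ[ν] CM n} (hu : u ∈ boundedShifts ν) :
    -u ∈ boundedShifts ν := by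
  obtain ⟨⟨U, hU, hUt, hUu⟩, C, hC⟩ := hu
  have hneg : ∀ᵐ ω ∂ν, ∀ᵐ t : I, (-u) ω t = -u ω t := by
    filter_upwards [AEEqFun.coeFn_neg u] with ω hω
    rw [hω]
    exact Lp.coeFn_neg _
  refine ⟨⟨fun t ω => -U t ω, hU.neg, fun t => (hUt t).neg, ?_⟩, C, ?_⟩
  · filter_upwards [hneg, hUu] with ω h1 h2
    filter_upwards [h1, h2] with t h3 h4
    rw [h3, h4]
  · filter_upwards [hneg, hC] with ω h1 h2
    filter_upwards [h1, h2] with t h3 h4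
    rwa [h3, norm_neg]

theorem add_mem_boundedShifts {u v : PathSpace n →ₘ[ν] CM n} (hu : u ∈ boundedShifts ν)
    (hv : v ∈ boundedShifts ν) : u + v ∈ boundedShifts ν := by
  obtain ⟨⟨U, hU, hUt, hUu⟩, C, hC⟩ := hu
  obtain ⟨⟨V, hV, hVt, hVv⟩, D, hD⟩ := hv
  have hadd : ∀ᵐ ω ∂ν, ∀ᵐ t : I, (u + v) ω t = u ω t + v ω t := by
    filter_upwards [AEEqFun.coeFn_add u v] with ω hω
    rw [hω]
    exact Lp.coeFn_add _ _
  refine ⟨⟨fun t ω => U t ω + V t ω, hU.add hV, fun t => (hUt t).add (hVt t), ?_⟩, C + D, ?_⟩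
  · filter_upwards [hadd, hUu, hVv] with ω h1 h2 h3
    filter_upwards [h1, h2, h3] with t h4 h5 h6
    rw [h4, h5, h6]
  · filter_upwards [hadd, hC, hD] with ω h1 h2 h3
    filter_upwards [h1, h2, h3] with t h4 h5 h6
    rw [h4]
    exact (norm_add_le _ _).trans (add_le_add h5 h6)

/-- The element of the Cameron-Martin space with density `∑ₛ l(s) 1_{(t, s ∨ t]}`. -/
noncomputable def stepSum (t : I) (J : Finset I) (l : I → State n) : CM n :=
  ∑ s ∈ J, stepCM t (max s t) (l s)

theorem inner_stepSum (t : I) (J : Finset I) (l : I → State n) (h : CM n) :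
    inner ℝ (stepSum t J l) h =
      ∑ s ∈ J, inner ℝ (l s) (cmPath h (max s t) - cmPath h t) := by
  rw [stepSum, sum_inner]
  exact Finset.sum_congr rfl fun s _ => inner_stepCM _ _ (le_max_right _ _) _ _

variable (ν) in
/-- The random shift equal to `stepSum t J l` on the event `A`, and to `0` outside of it. -/
noncomputable def stepShift (t : I) (J : Finset I) (l : I → State n) {A : Set (PathSpace n)}
    (hA : MeasurableSet A) : PathSpace n →ₘ[ν] CM n :=
  AEEqFun.mk (A.indicator fun _ => stepSum t J l)
    (stronglyMeasurable_const.indicator hA).aestronglyMeasurable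

theorem coeFn_stepShift (t : I) (J : Finset I) (l : I → State n) {A : Set (PathSpace n)}
    (hA : MeasurableSet A) :
    stepShift ν t J l hA =ᵐ[ν] A.indicator fun _ => stepSum t J l :=
  AEEqFun.coeFn_mk _ _

/-- The density vanishes up to time `t`, and after `t` the event `A` is already known; hence
adaptedness. -/
theorem stepShift_mem_boundedShifts {t : I} (J : Finset I) (l : I → State n)
    {A : Set (PathSpace n)} (hA : MeasurableSet[rawFiltration n t] A) :
    stepShift ν t J l (rawFiltration_le t _ hA) ∈ boundedShifts ν := by
  have hA' := rawFiltration_le t _ hA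
  let φ : I → State n := fun r => ∑ s ∈ J, (Set.Ioc t (max s t)).indicator (fun _ => l s) r
  have hφm : Measurable φ := Finset.measurable_fun_sum _ fun s _ =>
    measurable_const.indicator measurableSet_Ioc
  have hφ : stepSum t J l =ᵐ[volume] φ := by
    refine (Lp.coeFn_finsetSum _ _).trans ?_
    filter_upwards [J.eventually_all.2 fun s _ => coeFn_stepCM t (max s t) (l s)] with r hr
    rw [Finset.sum_apply]
    exact Finset.sum_congr rfl hr
  have hφ0 : ∀ r ≤ t, φ r = 0 := fun r hr => Finset.sum_eq_zero fun s _ =>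
    Set.indicator_of_notMem (fun h => absurd (h.1.trans_le hr) (lt_irrefl _)) _
  have hφb : ∀ r, ‖φ r‖ ≤ ∑ s ∈ J, ‖l s‖ := fun r =>
    norm_sum_le_of_le _ fun s _ => norm_indicator_le_norm_self (fun _ => l s) r
  have hden : ∀ᵐ ω ∂ν, ∀ᵐ r : I, stepShift ν t J l hA' ω r = A.indicator (fun _ => φ r) ω := by
    filter_upwards [coeFn_stepShift (ν := ν) t J l hA'] with ω hω
    rw [hω]
    by_cases h : ω ∈ A
    · simp only [Set.indicator_of_mem h]
      exact hφ
    · simp only [Set.indicator_of_notMem h]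
      exact Lp.coeFn_zero _ _ _
  refine ⟨⟨fun r ω => A.indicator (fun _ => φ r) ω, ?_, fun r => ?_, hden⟩, ∑ s ∈ J, ‖l s‖, ?_⟩
  · have : Function.uncurry (fun r ω => A.indicator (fun _ => φ r) ω) =
        (Prod.snd ⁻¹' A).indicator fun p : I × PathSpace n => φ p.1 := rfl
    rw [this]
    exact (hφm.comp measurable_fst).indicator (measurable_snd hA')
  · rcases le_or_gt r t with h | h
    · simp only [hφ0 r h, Set.indicator_zero]
      exact measurable_const
    · refine Measurable.indicator measurable_const ?_
      exact completedFiltration_mono id h.le _ (le_eventuallyMeasurableSpace _ hA)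
  · filter_upwards [hden] with ω hω
    filter_upwards [hω] with r hr
    rw [hr]
    refine (norm_indicator_le_norm_self _ _).trans (hφb r)

end Shifts

/-! ### Girsanov's theorem from the mass of the densities. -/

section Girsanov

variable {n : ℕ} {ν : Measure (PathSpace n)} {β : PathSpace n → PathSpace n}

theorem integral_norm_sq_eq (h : CM n) : ∫ s : I, ‖h s‖ ^ 2 = ‖h‖ ^ 2 := by
  rw [← real_inner_self_eq_norm_sq, L2.inner_def]
  simp only [real_inner_self_eq_norm_sq]

theorem wickExp_eq (p : PathSpace n →ₘ[ν] CM n) (ω : PathSpace n) :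
    wickExp β p ω = Real.exp (stochInt β p ω - (1 / 2) * ‖p ω‖ ^ 2) := by
  rw [wickExp, integral_norm_sq_eq]

variable [IsProbabilityMeasure ν]

theorem aemeasurable_wickExp (hβ : IsBrownianMotion ν β)
    (hfilt : ∀ t, completedFiltration ν β t = completedFiltration ν id t)
    {p : PathSpace n →ₘ[ν] CM n} (hp : p ∈ boundedShifts ν) : AEMeasurable (wickExp β p) ν := by
  have h1 := (isItoIntegral_stochInt hβ hfilt hp).1.aemeasurable
  have h2 : AEMeasurable (fun ω => ‖p ω‖) ν := p.aestronglyMeasurable.norm.aemeasurable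
  refine AEMeasurable.congr ?_ (ae_of_all _ fun ω => (wickExp_eq p ω).symm)
  exact Real.measurable_exp.comp_aemeasurable (h1.sub ((h2.pow_const 2).const_mul (1 / 2)))

theorem cmPath_neg (h : CM n) (t : I) : cmPath (-h) t = -cmPath h t := by
  rw [cmPath, cmPath, ← integral_neg]
  refine integral_congr_ae (ae_restrict_of_ae ?_)
  filter_upwards [Lp.coeFn_neg h] with s hs
  rw [hs, Pi.neg_apply]

/-- Additivity of the Itô integral with respect to a step shift. -/
theorem stochInt_add_stepShift (hβ : IsBrownianMotion ν β)
    (hfilt : ∀ t, completedFiltration ν β t = completedFiltration ν id t)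
    {p : PathSpace n →ₘ[ν] CM n} (hp : p ∈ boundedShifts ν) {t : I} (J : Finset I)
    (l : I → State n) {A : Set (PathSpace n)} (hA : MeasurableSet[rawFiltration n t] A) :
    stochInt β (p + stepShift ν t J l (rawFiltration_le t _ hA)) =ᵐ[ν] fun ω =>
      stochInt β p ω +
        A.indicator (fun ω => ∑ s ∈ J, inner ℝ (l s) (β ω (max s t) - β ω t)) ω := by
  have hA' := rawFiltration_le t _ hA
  set w := stepShift ν t J l hA' with hw
  have hwD : w ∈ boundedShifts ν := stepShift_mem_boundedShifts J l hA
  have hpw := add_mem_boundedShifts hp hwD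
  have hp2 := memLp_of_mem_boundedShifts hp
  have hw2 := memLp_of_mem_boundedShifts hwD
  have hpw2 := memLp_of_mem_boundedShifts hpw
  obtain ⟨hJ, hpJ⟩ := (isItoIntegral_stochInt hβ hfilt hp).mem_itoGraph hβ hp2
  obtain ⟨hJ', hpJ'⟩ := (isItoIntegral_stochInt hβ hfilt hpw).mem_itoGraph hβ hpw2
  have helem := fun s => hβ.exists_mem_elementaryIntegrals (a := t) (b := max s t)
    (le_max_right _ _) (ξ := A.indicator fun _ => l s)
    (measurable_const.indicator (le_eventuallyMeasurableSpace _ hA))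
    ⟨‖l s‖, fun ω => norm_indicator_le_norm_self (fun _ => l s) ω⟩
  choose q hq hq1 hq2 using helem
  have hsum : (∑ s ∈ J, q s) ∈ itoGraph ν β :=
    Submodule.sum_mem _ fun s _ => subset_closure (Submodule.subset_span (hq s))
  have h1 : (∑ s ∈ J, q s).1 = hw2.toLp w := by
    refine Lp.ext ?_
    rw [Prod.fst_sum]
    refine (Lp.coeFn_finsetSum _ _).trans ?_
    filter_upwards [J.eventually_all.2 fun s _ => hq1 s, hw2.coeFn_toLp,
      coeFn_stepShift (ν := ν) t J l hA'] with ω h1 h2 h3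
    rw [h2, hw, h3, Finset.sum_apply, Finset.sum_congr rfl h1]
    by_cases h : ω ∈ A
    · simp only [Set.indicator_of_mem h, stepSum]
    · simp only [Set.indicator_of_notMem h, map_zero, Finset.sum_const_zero]
  have h2 : hpw2.toLp _ = hp2.toLp p + (∑ s ∈ J, q s).1 := by
    rw [h1]
    refine Lp.ext ?_
    filter_upwards [hpw2.coeFn_toLp, hp2.coeFn_toLp, hw2.coeFn_toLp, AEEqFun.coeFn_add p w,
      Lp.coeFn_add (hp2.toLp p) (hw2.toLp w)] with ω h3 h4 h5 h6 h7
    rw [h3, h6, h7, Pi.add_apply, Pi.add_apply, h4, h5]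
  have h3 := (itoGraph ν β).add_mem hpJ hsum
  rw [← Prod.mk.eta (p := ∑ s ∈ J, q s), Prod.mk_add_mk, ← h2] at h3
  have h4 := snd_unique_of_mem_itoGraph hβ hfilt hpJ' h3
  have h5 : (∑ s ∈ J, q s).2 =ᵐ[ν]
      A.indicator (fun ω => ∑ s ∈ J, inner ℝ (l s) (β ω (max s t) - β ω t)) := by
    rw [Prod.snd_sum]
    refine (Lp.coeFn_finsetSum _ _).trans ?_
    filter_upwards [J.eventually_all.2 fun s _ => hq2 s] with ω h1
    rw [Finset.sum_apply, Finset.sum_congr rfl h1]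
    by_cases h : ω ∈ A
    · simp only [Set.indicator_of_mem h]
    · simp only [Set.indicator_of_notMem h, inner_zero_left, Finset.sum_const_zero]
  filter_upwards [hJ.coeFn_toLp, hJ'.coeFn_toLp, h5,
    Lp.coeFn_add (hJ.toLp _) (∑ s ∈ J, q s).2] with ω h6 h7 h8 h9
  rw [← h7, h4, h9, Pi.add_apply, h6, h8]

/-- The effect of a step shift on the Wick exponential. -/
theorem wickExp_sub_stepShift (hβ : IsBrownianMotion ν β)
    (hfilt : ∀ t, completedFiltration ν β t = completedFiltration ν id t)
    {u : PathSpace n →ₘ[ν] CM n} (hu : u ∈ boundedShifts ν) {X : PathSpace n → PathSpace n}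
    (hX : ∀ᵐ ω ∂ν, ∀ t, X ω t = β ω t + cmPath (u ω) t) {t : I} (J : Finset I)
    (l : I → State n) {A : Set (PathSpace n)} (hA : MeasurableSet[rawFiltration n t] A) :
    wickExp β (-(u + -stepShift ν t J l (rawFiltration_le t _ hA))) =ᵐ[ν] fun ω =>
      wickExp β (-u) ω * Real.exp (A.indicator (fun ω =>
        (∑ s ∈ J, inner ℝ (l s) (incrAfter t (X ω) s)) - ‖stepSum t J l‖ ^ 2 / 2) ω) := by
  have hA' := rawFiltration_le t _ hA
  have hcomm : -(u + -stepShift ν t J l hA') = -u + stepShift ν t J l hA' := by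
    rw [neg_add, neg_neg]
  rw [hcomm]
  filter_upwards [stochInt_add_stepShift hβ hfilt (neg_mem_boundedShifts hu) J l hA, hX,
    AEEqFun.coeFn_add (-u) (stepShift ν t J l hA'), AEEqFun.coeFn_neg u,
    coeFn_stepShift (ν := ν) t J l hA'] with ω h1 h2 h3 h4 h5
  rw [wickExp_eq, wickExp_eq, h1, h3, Pi.add_apply, h5, ← Real.exp_add]
  by_cases h : ω ∈ A
  · simp only [Set.indicator_of_mem h]
    -- The cross term of `‖-u + stepSum t J l‖²` supplies the drift that turns increments of `β`
    -- into increments of `X`.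
    have h6 : inner ℝ ((-u : PathSpace n →ₘ[ν] CM n) ω) (stepSum t J l) =
        - ∑ s ∈ J, inner ℝ (l s) (cmPath (u ω) (max s t) - cmPath (u ω) t) := by
      rw [real_inner_comm, inner_stepSum, h4, ← Finset.sum_neg_distrib]
      refine Finset.sum_congr rfl fun s _ => ?_
      rw [Pi.neg_apply, cmPath_neg, cmPath_neg, ← inner_neg_right]
      congr 1
      abel
    have h7 : ∑ s ∈ J, inner ℝ (l s) (incrAfter t (X ω) s) =
        ∑ s ∈ J, inner ℝ (l s) (β ω (max s t) - β ω t) +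
          ∑ s ∈ J, inner ℝ (l s) (cmPath (u ω) (max s t) - cmPath (u ω) t) := by
      rw [← Finset.sum_add_distrib]
      refine Finset.sum_congr rfl fun s _ => ?_
      rw [incrAfter_apply, h2, h2, ← inner_add_right]
      congr 1
      abel
    rw [norm_add_sq_real, h6, h7]
    congr 1
    ring
  · simp only [Set.indicator_of_notMem h, add_zero]

/-- If all the Girsanov densities have mass one, the Laplace transform of the increments after time
`t` of the shifted Brownian motion is explicit on each event of the past. -/
theorem setLIntegral_exp_incrAfter (hβ : IsBrownianMotion ν β)
    (hfilt : ∀ t, completedFiltration ν β t = completedFiltration ν id t)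
    (hmass : ∀ u ∈ boundedShifts ν, girsanovMeasure ν β u Set.univ = 1)
    {u : PathSpace n →ₘ[ν] CM n} (hu : u ∈ boundedShifts ν) {X : PathSpace n → PathSpace n}
    (hXm : AEMeasurable X ν) (hX : ∀ᵐ ω ∂ν, ∀ t, X ω t = β ω t + cmPath (u ω) t) {t : I}
    (J : Finset I) (l : I → State n) {A : Set (PathSpace n)}
    (hA : MeasurableSet[rawFiltration n t] A) :
    ∫⁻ ω in A, ENNReal.ofReal (Real.exp (∑ s ∈ J, inner ℝ (l s) (incrAfter t (X ω) s)))
      ∂(girsanovMeasure ν β u) =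
    girsanovMeasure ν β u A * ENNReal.ofReal (Real.exp (‖stepSum t J l‖ ^ 2 / 2)) := by
  have hA' := rawFiltration_le t _ hA
  set μ := girsanovMeasure ν β u with hμ
  have hμu : μ Set.univ = 1 := hmass u hu
  set c := ‖stepSum t J l‖ ^ 2 / 2 with hc
  set Z : PathSpace n → ℝ := fun ω => ∑ s ∈ J, inner ℝ (l s) (incrAfter t (X ω) s) with hZ
  have hwD := neg_mem_boundedShifts (stepShift_mem_boundedShifts (ν := ν) J l hA)
  -- The shift `u - w`, with `w` the step shift on `A`, has a density of mass one. Outside `A` this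
  -- density agrees with that of `u`, so the contribution of the complement cancels.
  have h1 := hmass _ (add_mem_boundedShifts hu hwD)
  have hwu := (aemeasurable_wickExp hβ hfilt (neg_mem_boundedShifts hu)).ennreal_ofReal
  rw [girsanovMeasure, withDensity_apply _ MeasurableSet.univ, Measure.restrict_univ] at h1
  have hZm : AEMeasurable Z ν := Finset.aemeasurable_fun_sum _ fun s _ =>
    aemeasurable_const.inner (((measurable_eval s).comp (measurable_incrAfter t)).comp_aemeasurable
      hXm)
  have hind : AEMeasurable (fun ω => ENNReal.ofReal (Real.exp (A.indicator (fun ω => Z ω - c) ω)))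
      ν := (Real.measurable_exp.comp_aemeasurable
        ((hZm.sub_const c).indicator hA')).ennreal_ofReal
  have h2 : ∫⁻ ω, ENNReal.ofReal (Real.exp (A.indicator (fun ω => Z ω - c) ω)) ∂μ = 1 := by
    rw [hμ, girsanovMeasure, lintegral_withDensity_eq_lintegral_mul₀ hwu hind, ← h1]
    refine lintegral_congr_ae ?_
    filter_upwards [wickExp_sub_stepShift hβ hfilt hu hX J l hA] with ω hω
    rw [hω, Pi.mul_apply,
      ENNReal.ofReal_mul (show 0 ≤ wickExp β (-u) ω from (Real.exp_pos _).le)]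
  have h3 : ∫⁻ ω in A, ENNReal.ofReal (Real.exp (Z ω - c)) ∂μ = μ A := by
    rw [← lintegral_add_compl _ hA'] at h2
    have h4 : ∫⁻ ω in A, ENNReal.ofReal (Real.exp (A.indicator (fun ω => Z ω - c) ω)) ∂μ =
        ∫⁻ ω in A, ENNReal.ofReal (Real.exp (Z ω - c)) ∂μ :=
      setLIntegral_congr_fun hA' fun ω hω => by simp only [Set.indicator_of_mem hω]
    have h5 : ∫⁻ ω in Aᶜ, ENNReal.ofReal (Real.exp (A.indicator (fun ω => Z ω - c) ω)) ∂μ =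
        μ Aᶜ := by
      rw [← setLIntegral_one]
      refine setLIntegral_congr_fun hA'.compl fun ω hω => ?_
      simp only [Set.indicator_of_notMem hω, Real.exp_zero, ENNReal.ofReal_one]
    rw [h4, h5, ← hμu, ← measure_add_measure_compl hA'] at h2
    refine (ENNReal.add_left_inj ?_).1 h2
    exact ne_top_of_le_ne_top (hμu ▸ ENNReal.one_ne_top) (measure_mono (Set.subset_univ _))
  rw [← h3, ← lintegral_mul_const' _ _ ENNReal.ofReal_ne_top]
  refine lintegral_congr fun ω => ?_
  rw [← ENNReal.ofReal_mul (Real.exp_pos _).le, ← Real.exp_add, sub_add_cancel]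

/-- Under the Girsanov measure, the increments after time `t` of the shifted Brownian motion are
independent of the past up to `t` of the whole filtration. -/
theorem indep_incrAfter (hβ : IsBrownianMotion ν β)
    (hfilt : ∀ t, completedFiltration ν β t = completedFiltration ν id t)
    (hmass : ∀ u ∈ boundedShifts ν, girsanovMeasure ν β u Set.univ = 1)
    {u : PathSpace n →ₘ[ν] CM n} (hu : u ∈ boundedShifts ν) {X : PathSpace n → PathSpace n}
    (hXm : AEMeasurable X ν) (hX : ∀ᵐ ω ∂ν, ∀ t, X ω t = β ω t + cmPath (u ω) t) (t : I) :
    Indep (completedFiltration ν id t)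
      (MeasurableSpace.comap (fun ω => incrAfter t (X ω)) inferInstance)
      (girsanovMeasure ν β u) := by
  set μ := girsanovMeasure ν β u with hμ
  have hac : μ ≪ ν := withDensity_absolutelyContinuous _ _
  have : IsProbabilityMeasure μ := ⟨hmass u hu⟩
  have hYm : AEMeasurable (fun ω => incrAfter t (X ω)) μ :=
    (measurable_incrAfter t).comp_aemeasurable (hXm.mono_ac hac)
  -- The Laplace transform on `A` is `μ A` times a constant independent of `A`; taking `A` to be the
  -- whole space identifies that constant as the unconditional Laplace transform.
  have key : ∀ A, MeasurableSet[rawFiltration n t] A →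
      (μ.restrict A).map (fun ω => incrAfter t (X ω)) =
        (μ A) • μ.map (fun ω => incrAfter t (X ω)) := by
    intro A hA
    have hm : ∀ (J : Finset I) (l : I → State n), Measurable fun f : PathSpace n =>
        ENNReal.ofReal (Real.exp (∑ s ∈ J, inner ℝ (l s) (f s))) := fun J l =>
      (Real.measurable_exp.comp (Finset.measurable_fun_sum _ fun s _ =>
        measurable_const.inner (measurable_eval s))).ennreal_ofReal
    have : IsFiniteMeasure ((μ A) • μ.map (fun ω => incrAfter t (X ω))) :=
      Measure.smul_finite _ (measure_ne_top _ _)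
    refine ext_of_lintegral_exp (fun J l => ?_) (fun J l => ?_)
    · rw [lintegral_map' (hm J l).aemeasurable hYm.restrict,
        setLIntegral_exp_incrAfter hβ hfilt hmass hu hXm hX J l hA]
      exact ENNReal.mul_ne_top (measure_ne_top _ _) ENNReal.ofReal_ne_top
    · have huniv := setLIntegral_exp_incrAfter hβ hfilt hmass hu hXm hX J l
        (@MeasurableSet.univ _ (rawFiltration n t))
      rw [Measure.restrict_univ, ← hμ, measure_univ, one_mul] at huniv
      rw [lintegral_map' (hm J l).aemeasurable hYm.restrict, lintegral_smul_measure,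
        lintegral_map' (hm J l).aemeasurable hYm,
        setLIntegral_exp_incrAfter hβ hfilt hmass hu hXm hX J l hA, huniv, smul_eq_mul]
  rw [Indep_iff]
  rintro A - ⟨A', hA', hAA'⟩ ⟨D, hD, rfl⟩
  have hAA : A =ᵐ[μ] A' := hac.ae_le hAA'
  rw [measure_congr (hAA.inter (EventuallyEq.refl _
    ((fun ω => incrAfter t (X ω)) ⁻¹' D))), measure_congr hAA]
  have h1 := congrArg (fun m => m D) (key A' hA')
  simp only [Measure.smul_apply, smul_eq_mul] at h1
  rw [Measure.map_apply_of_aemeasurable hYm.restrict hD,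
    Measure.map_apply_of_aemeasurable hYm hD,
    Measure.restrict_apply' (rawFiltration_le t _ hA'), Set.inter_comm] at h1
  exact h1

end Girsanov

/-! ### Freezing the future of the shifted Brownian motion. -/

section LeftInverse

variable {n : ℕ} {ν : Measure (PathSpace n)} {β : PathSpace n → PathSpace n}

theorem girsanovMeasure_absolutelyContinuous (u : PathSpace n →ₘ[ν] CM n) :
    girsanovMeasure ν β u ≪ ν :=
  withDensity_absolutelyContinuous _ _

variable [IsProbabilityMeasure ν]

theorem absolutelyContinuous_girsanovMeasure (hβ : IsBrownianMotion ν β)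
    (hfilt : ∀ t, completedFiltration ν β t = completedFiltration ν id t)
    {u : PathSpace n →ₘ[ν] CM n} (hu : u ∈ boundedShifts ν) : ν ≪ girsanovMeasure ν β u := by
  refine withDensity_absolutelyContinuous'
    (aemeasurable_wickExp hβ hfilt (neg_mem_boundedShifts hu)).ennreal_ofReal ?_
  exact ae_of_all _ fun ω => (ENNReal.ofReal_pos.2 (Real.exp_pos _)).ne'

/-- The shifted Brownian motion is adapted to the filtration of the coordinate process. -/
theorem measurable_stopAt_shift
    (hfilt : ∀ t, completedFiltration ν β t = completedFiltration ν id t)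
    {u : PathSpace n →ₘ[ν] CM n} (hu : u ∈ boundedShifts ν) {X : PathSpace n → PathSpace n}
    (hX : ∀ᵐ ω ∂ν, ∀ t, X ω t = β ω t + cmPath (u ω) t) (t : I) :
    Measurable[completedFiltration ν id t] fun ω => stopAt t (X ω) := by
  obtain ⟨U, C, hU, hUt, hC, hUu⟩ := exists_bounded_density hu
  refine @measurable_pathSpace _ _ (completedFiltration ν id t) _ fun s => ?_
  have hs : min s t ≤ t := min_le_right _ _
  have h1 : Measurable[completedFiltration ν id t] fun ω => ∫ r in Set.Iic (min s t), U r ω :=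
    measurable_setIntegral measurableSet_Iic hU
      (fun r hr => (hUt r).mono (completedFiltration_mono id (le_trans hr hs)) le_rfl) hC
  refine measurable_completedFiltration_congr ((measurable_brownian hfilt hs).add h1) ?_
  filter_upwards [hX, hUu] with ω h2 h3
  rw [stopAt_apply, h2, cmPath, integral_congr_ae (ae_restrict_of_ae h3)]
  rfl

/-- An event of the past up to `t` that is determined by the whole path of the shifted Brownian
motion is determined by its path up to `t`. -/
theorem exists_ae_eq_stopAt (hβ : IsBrownianMotion ν β)
    (hfilt : ∀ t, completedFiltration ν β t = completedFiltration ν id t)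
    (hmass : ∀ u ∈ boundedShifts ν, girsanovMeasure ν β u Set.univ = 1)
    {u : PathSpace n →ₘ[ν] CM n} (hu : u ∈ boundedShifts ν) {X : PathSpace n → PathSpace n}
    (hXm : AEMeasurable X ν) (hX : ∀ᵐ ω ∂ν, ∀ t, X ω t = β ω t + cmPath (u ω) t) {t : I}
    {A : Set (PathSpace n)} (hA : MeasurableSet[completedFiltration ν id t] A)
    {D : Set (PathSpace n)} (hD : MeasurableSet D) (hAD : ∀ᵐ ω ∂ν, ω ∈ A ↔ X ω ∈ D) :
    ∃ y : PathSpace n, ∀ᵐ ω ∂ν, ω ∈ A ↔ stopAt t (X ω) + y ∈ D := by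
  set μ := girsanovMeasure ν β u with hμ
  have hμν : μ ≪ ν := girsanovMeasure_absolutelyContinuous u
  have hνμ : ν ≪ μ := absolutelyContinuous_girsanovMeasure hβ hfilt hu
  have : IsProbabilityMeasure μ := ⟨hmass u hu⟩
  -- Membership in `A` and the stopped path form a single variable of the past, jointly independent
  -- of the later increments `Y`. Their joint law is therefore a product, and `X` is the sum of its
  -- stopped path and `Y`.
  let P : PathSpace n → Prop × PathSpace n := fun ω => (ω ∈ A, stopAt t (X ω))
  let Y : PathSpace n → PathSpace n := fun ω => incrAfter t (X ω)
  have hP : Measurable[completedFiltration ν id t] P :=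
    have hAm : Measurable[completedFiltration ν id t] fun ω => ω ∈ A :=
      (@measurable_mem _ A (completedFiltration ν id t)).2 hA
    hAm.prodMk (measurable_stopAt_shift hfilt hu hX t)
  have hPm : AEMeasurable P μ := (aemeasurable_of_completedFiltration hP).mono_ac hμν
  have hYm : AEMeasurable Y μ := (measurable_incrAfter t).comp_aemeasurable (hXm.mono_ac hμν)
  have hind : IndepFun Y P μ := by
    refine IndepFun.symm ?_
    rw [IndepFun_iff_Indep]
    exact indep_of_indep_of_le_left (indep_incrAfter hβ hfilt hmass hu hXm hX t)
      (measurable_iff_comap_le.1 hP)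
  have hprod := (indepFun_iff_map_prod_eq_prod_map_map hYm hPm).1 hind
  have hB : MeasurableSet {p : PathSpace n × (Prop × PathSpace n) | p.2.1 ↔ p.2.2 + p.1 ∈ D} := by
    have h1 : MeasurableSet {p : PathSpace n × (Prop × PathSpace n) | p.2.1} :=
      measurableSet_setOfPred.2 (measurable_fst.comp measurable_snd)
    have h2 : MeasurableSet {p : PathSpace n × (Prop × PathSpace n) | p.2.2 + p.1 ∈ D} :=
      ((measurable_snd.comp measurable_snd).add measurable_fst) hD
    exact measurableSet_setOfPred.2 ((measurableSet_setOfPred.1 h1).iff (measurableSet_setOfPred.1 h2))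
  have hae : ∀ᵐ p ∂(μ.map Y).prod (μ.map P), p.2.1 ↔ p.2.2 + p.1 ∈ D := by
    rw [← hprod, ae_map_iff (hYm.prodMk hPm) hB]
    filter_upwards [hμν.ae_le hAD] with ω hω
    simp only [P, Y, stopAt_add_incrAfter]
    exact hω
  have : IsProbabilityMeasure (μ.map Y) := Measure.isProbabilityMeasure_map hYm
  -- Almost every value of `Y` works by Fubini; one is fixed, and the equivalence of `μ` and `ν`
  -- returns the conclusion to `ν`.
  obtain ⟨y, hy⟩ := (Measure.ae_ae_of_ae_prod hae).exists
  exact ⟨y, hνμ.ae_le (ae_of_ae_map hPm hy)⟩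

end LeftInverse

end WienerShift

/-! ### Inversion of the perturbation. -/

theorem theorem1 {n : ℕ} (hn : 1 ≤ n)
    (ν : Measure (PathSpace n)) [IsProbabilityMeasure ν]
    -- the Brownian motion and the family of perturbations of the coordinate process
    (β : PathSpace n → PathSpace n)
    (W : (PathSpace n →ₘ[ν] CM n) → PathSpace n → PathSpace n)
    (hW : ∀ u ∈ boundedShifts ν, AEMeasurable (W u) ν)
    -- (i) a Brownian motion with the same filtration as the coordinate process
    (hβ : IsBrownianMotion ν β)
    (hfilt : ∀ t, completedFiltration ν β t = completedFiltration ν id t)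
    -- (ii) no perturbation
    (hzero : W 0 =ᵐ[ν] id)
    -- (iii) change of measure
    (hlaw : ∀ u ∈ boundedShifts ν, Measure.map (W u) (girsanovMeasure ν β u) = ν)
    -- (iv) action on the Brownian motion
    (hshift : ∀ u ∈ boundedShifts ν, ∀ᵐ ω ∂ν, ∀ t, β (W u ω) t = β ω t + cmPath (u ω) t)
    -- (v) composition
    (hcomp : ∀ u ∈ boundedShifts ν, ∀ v ∈ boundedShifts ν, ∀ w ∈ boundedShifts ν,
      (∀ᵐ ω ∂ν, w ω = v ω + u (W v ω)) → W u ∘ W v =ᵐ[ν] W w)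
    -- a left-invertible perturbation
    (u : PathSpace n →ₘ[ν] CM n) (hu : u ∈ boundedShifts ν)
    (V : PathSpace n → PathSpace n) (hV : Measurable V)
    (hVu : V ∘ W u =ᵐ[ν] id) :
    W u ∘ V =ᵐ[ν] id ∧
    ∃ hq : Measure.QuasiMeasurePreserving V ν ν,
      ∃ v : PathSpace n →ₘ[ν] CM n,
        v = -(u.compQuasiMeasurePreserving V hq) ∧
        v ∈ boundedShifts ν ∧
        V =ᵐ[ν] W v ∧
        Measure.map (W u) ν = ν.withDensity (fun ω => ENNReal.ofReal (wickExp β (-v) ω)) ∧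
        Measure.map (W v) ν = ν.withDensity (fun ω => ENNReal.ofReal (wickExp β (-u) ω)) := by
  have hac : ∀ w, girsanovMeasure ν β w ≪ ν := girsanovMeasure_absolutelyContinuous
  have hac' : ∀ w ∈ boundedShifts ν, ν ≪ girsanovMeasure ν β w := fun w hw =>
    absolutelyContinuous_girsanovMeasure hβ hfilt hw
  have hWm : ∀ w ∈ boundedShifts ν, AEMeasurable (W w) (girsanovMeasure ν β w) := fun w hw =>
    (hW w hw).mono_ac (hac w)
  have hmass : ∀ w ∈ boundedShifts ν, girsanovMeasure ν β w Set.univ = 1 := by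
    intro w hw
    have h := congrArg (fun m => m Set.univ) (hlaw w hw)
    simp only [measure_univ] at h
    rwa [Measure.map_apply_of_aemeasurable (hWm w hw) MeasurableSet.univ] at h
  -- Almost sure properties may be composed with `W w`, because `W w` carries a measure equivalent
  -- to `ν` to `ν`.
  have hWae : ∀ w ∈ boundedShifts ν, ∀ {p : PathSpace n → Prop}, (∀ᵐ x ∂ν, p x) →
      ∀ᵐ ω ∂ν, p (W w ω) := by
    intro w hw p hp
    rw [← hlaw w hw] at hp
    exact (hac' w hw).ae_le (ae_of_ae_map (hWm w hw) hp)
  -- the image of `ν` under `V`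
  have hVν : Measure.map V ν = girsanovMeasure ν β u := by
    have h : Measure.map V (Measure.map (W u) (girsanovMeasure ν β u)) = girsanovMeasure ν β u := by
      rw [AEMeasurable.map_map_of_aemeasurable hV.aemeasurable (hWm u hu),
        Measure.map_congr ((hac u).ae_eq hVu), Measure.map_id]
    rwa [hlaw u hu] at h
  have hq : Measure.QuasiMeasurePreserving V ν ν := ⟨hV, hVν ▸ hac u⟩
  -- `V` is a right inverse
  have hWV : W u ∘ V =ᵐ[ν] id := by
    -- A measurable version of `W u` makes the set of fixed points measurable, so that the claim can
    -- be tested on the image law.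
    have hmk := (hW u hu).ae_eq_mk
    have hset : MeasurableSet {x | (hW u hu).mk (W u) (V x) = x} :=
      measurableSet_eq_fun ((hW u hu).measurable_mk.comp hV) measurable_id
    have h1 : ∀ᵐ x ∂ν, (hW u hu).mk (W u) (V x) = x := by
      have h2 : ∀ᵐ x ∂(Measure.map (W u) (girsanovMeasure ν β u)),
          (hW u hu).mk (W u) (V x) = x := by
        rw [ae_map_iff (hWm u hu) hset]
        refine (hac u).ae_le ?_
        filter_upwards [hVu, hmk] with ω h3 h4
        rw [Function.comp_apply, id] at h3
        rw [h3, h4]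
      rwa [hlaw u hu] at h2
    filter_upwards [h1, hq.ae hmk] with x h3 h4
    rw [Function.comp_apply, h4, h3, id]
  -- `V` is adapted
  have hβm : AEMeasurable β ν :=
    aemeasurable_of_completedFiltration (measurable_brownian_one hfilt)
  have hXm : AEMeasurable (fun ω => β (W u ω)) ν := by
    refine AEMeasurable.mono_ac ?_ (hac' u hu)
    refine AEMeasurable.comp_aemeasurable (g := β) ?_ (hWm u hu)
    rwa [hlaw u hu]
  have hone : completedFiltration ν id 1 =
      eventuallyMeasurableSpace (MeasurableSpace.comap β inferInstance) (ae ν) := by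
    rw [← hfilt 1, completedFiltration_one]
  have hVadapted : ∀ t, ∀ A, MeasurableSet[completedFiltration ν id t] A →
      MeasurableSet[completedFiltration ν id t] (V ⁻¹' A) := by
    intro t A hA
    obtain ⟨A', hA', hAA'⟩ := hA
    have hVA : MeasurableSet[completedFiltration ν id 1] (V ⁻¹' A') :=
      measurable_completedFiltration_one hV (rawFiltration_le t _ hA')
    rw [hone] at hVA
    obtain ⟨D, hD, hVD⟩ := ae_eq_preimage_of_measurable_comap hVA
    -- The identity `V⁻¹ A' = {β ∈ D}` is read at the point `W u ω`, where `V` returns `ω`.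
    have hAD : ∀ᵐ ω ∂ν, ω ∈ A' ↔ β (W u ω) ∈ D := by
      filter_upwards [hWae u hu hVD.mem_iff, hVu] with ω h1 h2
      rw [Function.comp_apply, id] at h2
      rw [Set.mem_preimage, h2, Set.mem_preimage] at h1
      exact h1
    obtain ⟨y, hy⟩ := exists_ae_eq_stopAt hβ hfilt hmass hu hXm (hshift u hu)
      (le_eventuallyMeasurableSpace _ hA') hD hAD
    have hC : MeasurableSet[completedFiltration ν id t] {ω | stopAt t (β ω) + y ∈ D} :=
      ((measurable_id.add_const y).comp (measurable_brownian_stopAt hfilt t)) hD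
    refine measurableSet_completedFiltration_of_ae hC ?_
    refine eventuallyEq_set.2 ?_
    -- The frozen description of `A'` is read at `V ω`, where `β (W u (V ω)) = β ω`.
    filter_upwards [hq.ae hy, hq.ae hAA'.mem_iff, hWV] with ω h1 h2 h3
    rw [Function.comp_apply, id] at h3
    rw [h3] at h1
    exact h2.trans h1
  have hcoe := AEEqFun.coeFn_compQuasiMeasurePreserving u hq
  have hcompD : u.compQuasiMeasurePreserving V hq ∈ boundedShifts ν := by
    obtain ⟨⟨U, hU, hUt, hUu⟩, C, hC⟩ := hu
    refine ⟨⟨fun t ω => U t (V ω), hU.comp (measurable_id.prodMap hV),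
      fun t B hB => hVadapted t _ (hUt t hB), ?_⟩, C, ?_⟩
    · filter_upwards [hcoe, hq.ae hUu] with ω h1 h2
      rw [h1]
      exact h2
    · filter_upwards [hcoe, hq.ae hC] with ω h1 h2
      rw [h1]
      exact h2
  set v : PathSpace n →ₘ[ν] CM n := -(u.compQuasiMeasurePreserving V hq) with hv
  have hvD : v ∈ boundedShifts ν := neg_mem_boundedShifts hcompD
  have hvV : ∀ᵐ ω ∂ν, v ω = -u (V ω) := by
    filter_upwards [AEEqFun.coeFn_neg (u.compQuasiMeasurePreserving V hq), hcoe] with ω h1 h2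
    rw [hv, h1, Pi.neg_apply, h2, Function.comp_apply]
  -- the coordinate process is a function of the Brownian motion
  obtain ⟨Φ, hΦ⟩ : ∃ Φ : PathSpace n → PathSpace n, ∀ᵐ x ∂ν, x = Φ (β x) := by
    have h1 : Measurable[eventuallyMeasurableSpace (MeasurableSpace.comap β inferInstance) (ae ν)]
        (id : PathSpace n → PathSpace n) := by
      rw [← hone]
      exact measurable_completedFiltration_one measurable_id
    obtain ⟨g, hg, hgid⟩ := exists_measurable_eventuallyEq h1
    obtain ⟨Φ, -, rfl⟩ := hg.exists_eq_measurable_comp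
    exact ⟨Φ, hgid⟩
  have hVW : V =ᵐ[ν] W v := by
    -- Both `V` and `W v` are recovered by `Φ` from their images under `β`, so only these images are
    -- compared.
    filter_upwards [hq.ae hΦ, hWae v hvD hΦ, hshift v hvD, hq.ae (hshift u hu), hvV, hWV]
      with ω h1 h2 h3 h4 h5 h6
    rw [Function.comp_apply, id] at h6
    rw [h1, h2]
    congr 1
    ext1 t
    have h7 := h4 t
    rw [h6] at h7
    rw [h3, h5, cmPath_neg, h7, add_neg_cancel_right]
  refine ⟨hWV, hq, v, rfl, hvD, hVW, ?_, ?_⟩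
  -- Since `ν` is the image of `girsanovMeasure ν β v` under `W v`, applying `W u` brings that
  -- measure back.
  · have hWW : W u ∘ W v =ᵐ[ν] id := by
      filter_upwards [hWV, hVW] with ω h1 h2
      rw [Function.comp_apply, ← h2]
      exact h1
    change _ = girsanovMeasure ν β v
    conv_lhs => rw [← hlaw v hvD]
    rw [AEMeasurable.map_map_of_aemeasurable (by rw [hlaw v hvD]; exact hW u hu) (hWm v hvD),
      Measure.map_congr ((hac v).ae_eq hWW), Measure.map_id]
  · rw [← Measure.map_congr hVW]
    exact hVν
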